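/- Let $k$ be a commutative artinian ring, $J$ a minimal injective cogenerator of the category of $k$-modules and $D=\mathrm{Hom}_k(-,J)$. Let $n\ge 1$ and let $(\mathcal C,\mathbb E,\mathfrak s)$ be a $k$-linear, Krull–Schmidt $n$-exangulated category (in the sense of Herschend–Liu–Nakaoka) which is Ext-finite, i.e. every $\mathbb E(A,B)$ is a finitely generated $k$-module. A morphism $f:A\to B$ is called projectively (injectively) trivial if $\mathbb E(f,Z)=0$ (resp. $\mathbb E(Z,f)=0$) for every $Z$; let $\mathcal P$ and $\mathcal I$ be the ideals of projectively and injectively trivial morphisms, and $\underline{\mathcal C}=\mathcal C/\mathcal P$, $\overline{\mathcal C}=\mathcal C/\mathcal I$ the stable and costable categories. Assume: * (Auslander–Reiten–Serre duality) there is given a $k$-linear equivalence $\tau_n:\underline{\mathcal C}\to\overline{\mathcal C}$, with quasi-inverse $\tau_n^-$ and counit $\theta:\tau_n^-\tau_n\to\mathrm{Id}$ of the adjoint equivalence $(\tau_n^-,\tau_n)$, and $k$-linear isomorphisms $\Phi_{A,B}:D\mathbb E(A,B)\to\overline{\mathcal C}(B,\tau_nA)$, natural in $A,B\in\mathcal C$;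 * for all composable $f:A\to B$, $g:B\to C$: if $g\circ f$ is a deflation then so is $g$, and if $g\circ f$ is an inflation then so is $f$. Let $\Psi_{A,B}:D\mathbb E(A,B)\to\underline{\mathcal C}(\tau_n^-B,A)$ be the isomorphism $\varphi\mapsto\theta_A\circ\tau_n^-(\Phi_{A,B}(\varphi))$. Fix objects $X,Y\in\mathcal C$. For morphisms $f,f'$ ending in $Y$ write $[f\rangle\le[f'\rangle$ if $f$ factors through $f'$; this is a partial order on the set $[\to Y\rangle$ of right equivalence classes ($f$ and $f'$ being right equivalent if each factors through the other). Let $[\to Y\rangle_{\rm def}$ be the set of classes of deflations, and for an object $C$ let ${}^{C}[\to Y\rangle_{\rm def}$ be the set of those classes in it that are right $C$-determined, where $f:W\to Y$ is right $C$-determined if a morphism $g:L\to Y$ factors through $f$ whenever $g\circ h$ factors through $f$ for all $h:C\to L$. Let ${}_{X}[\to Y\rangle_{\rm def}$ be the set of classes containing the last morphism $f$ of some distinguished $n$-exangle $X_0\to X_1\to\cdots\to W\xrightarrow{f}Y\dashrightarrow$ with $X_0\in\mathrm{add}\,X$. Write $\mathrm{Sub}$ for the poset of all submodules and $\mathrm{sub}$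 for that of the finitely generated ones. Then: 1. ${}_{X}[\to Y\rangle_{\rm def}={}^{\tau_n^-X}[\to Y\rangle_{\rm def}$. 2. The following maps are well defined: $$\xi_{X,Y}:{}^{\tau_n^-X}[\to Y\rangle_{\rm def}\to\mathrm{sub}_{\mathrm{End}_{\mathcal C}(X)}\mathbb E(Y,X),\qquad [f\rangle\mapsto\{g_*\delta\mid g\in\mathcal C(A,X)\},$$ where $\delta\in\mathbb E(Y,A)$ is the extension of any distinguished $n$-exangle with last morphism $f$; $$\Upsilon_{X,Y}:\mathrm{sub}_{\mathrm{End}_{\mathcal C}(X)}\mathbb E(Y,X)\to\mathrm{sub}_{\mathrm{End}_{\mathcal C}(\tau_n^-X)^{\rm op}}\underline{\mathcal C}(\tau_n^-X,Y),\qquad F\mapsto\{h\mid \Psi_{Y,X}^{-1}(h)|_F=0\},$$ i.e. $\Upsilon_{X,Y}(F)$ is the kernel of $\underline{\mathcal C}(\tau_n^-X,Y)\xrightarrow{\Psi_{Y,X}^{-1}}D\mathbb E(Y,X)\to DF$; $$\eta_{\tau_n^-X,Y}:{}^{\tau_n^-X}[\to Y\rangle_{\rm def}\to\mathrm{sub}_{\mathrm{End}_{\mathcal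 C}(\tau_n^-X)^{\rm op}}\underline{\mathcal C}(\tau_n^-X,Y),\qquad [f\rangle\mapsto\mathrm{Im}\,\underline{\mathcal C}(\tau_n^-X,f).$$ 3. The triangle commutes: $\eta_{\tau_n^-X,Y}=\Upsilon_{X,Y}\circ\xi_{X,Y}$. 4. The restricted Auslander bijection at $Y$ relative to $\tau_n^-X$ holds: $\eta_{\tau_n^-X,Y}$ is an isomorphism of posets from ${}^{\tau_n^-X}[\to Y\rangle_{\rm def}$ onto $\mathrm{sub}_{\mathrm{End}_{\mathcal C}(\tau_n^-X)^{\rm op}}\underline{\mathcal C}(\tau_n^-X,Y)$, and every submodule in $\mathrm{Sub}_{\mathrm{End}_{\mathcal C}(\tau_n^-X)^{\rm op}}\underline{\mathcal C}(\tau_n^-X,Y)$ is a value of it. -/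

import Mathlib

open CategoryTheory CategoryTheory.Limits Opposite

universe w v u uk

noncomputable section

namespace NExang

attribute [local instance] hasBinaryBiproducts_of_finite_biproducts

/-! ### Modules, Krull-Schmidt categories, additive closures -/

/-- `J` is an injective cogenerator of the category of `k`-modules. -/
def IsInjectiveCogenerator (k : Type uk) [CommRing k] (J : Type uk) [AddCommGroup J]
    [Module k J] : Prop :=
  Module.Injective k J ∧
    ∀ (M : Type uk) [AddCommGroup M] [Module k M] (m : M), m ≠ 0 →
      ∃ φ : M →ₗ[k] J, φ m ≠ 0

/-- `J` is a minimal injective cogenerator: no proper submodule of it is an injective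
cogenerator. -/
def IsMinimalInjectiveCogenerator (k : Type uk) [CommRing k] (J : Type uk) [AddCommGroup J]
    [Module k J] : Prop :=
  IsInjectiveCogenerator k J ∧
    ∀ N : Submodule k J, IsInjectiveCogenerator k N → N = ⊤

/-- Every object is a finite direct sum of objects with local endomorphism rings. -/
def IsKrullSchmidt (𝒞 : Type u) [Category.{v} 𝒞] [Preadditive 𝒞] [HasFiniteBiproducts 𝒞] :
    Prop :=
  ∀ X : 𝒞, ∃ (m : ℕ) (Y : Fin m → 𝒞),
    (∀ i, IsLocalRing (End (Y i))) ∧ Nonempty (X ≅ ⨁ Y)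

/-- `Z` belongs to `add X`: it is a direct summand of a finite direct sum of copies of `X`. -/
def InAdd {𝒞 : Type u} [Category.{v} 𝒞] [Preadditive 𝒞] [HasFiniteBiproducts 𝒞]
    (X Z : 𝒞) : Prop :=
  ∃ (m : ℕ) (Z' : 𝒞), Nonempty (Z ⊞ Z' ≅ ⨁ fun _ : Fin m => X)

/-! ### Right equivalence classes of morphisms to an object -/

section Classes

variable {𝒞 : Type u} [Category.{v} 𝒞]

/-- A morphism with target `Y`. -/
structure MorTo (Y : 𝒞) where
  /-- the source -/
  src : 𝒞
  /-- the morphism -/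
  hom : src ⟶ Y

/-- `f ≤ g` means that `f` factors through `g`. -/
instance (Y : 𝒞) : Preorder (MorTo Y) where
  le f g := ∃ v : f.src ⟶ g.src, v ≫ g.hom = f.hom
  le_refl f := ⟨𝟙 _, Category.id_comp _⟩
  le_trans f g h := by
    rintro ⟨v, hv⟩ ⟨w, hw⟩
    exact ⟨v ≫ w, by rw [Category.assoc, hw, hv]⟩

/-- The poset `[→ Y⟩` of right equivalence classes of morphisms to `Y`: two morphisms are right
equivalent if each factors through the other, and `[f⟩ ≤ [g⟩` if `f` factors through `g`. -/
abbrev RightClass (Y : 𝒞) := Antisymmetrization (MorTo Y) (· ≤ ·)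

/-- The right equivalence class `[f⟩` of `f`. -/
def rightClass {W Y : 𝒞} (f : W ⟶ Y) : RightClass Y :=
  toAntisymmetrization (· ≤ ·) (⟨W, f⟩ : MorTo Y)

/-- `f` is right `C`-determined: a morphism `g` to the target of `f` factors through `f`
as soon as `h ≫ g` factors through `f` for every `h` with source `C`. -/
def RightDetermined (C : 𝒞) {W Y : 𝒞} (f : W ⟶ Y) : Prop :=
  ∀ ⦃L : 𝒞⦄ (g : L ⟶ Y), (∀ h : C ⟶ L, ∃ t : C ⟶ W, t ≫ f = h ≫ g) →
    ∃ s : L ⟶ W, s ≫ f = g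

/-- The classes in `[→ Y⟩` that are right `C`-determined. -/
def determinedClasses (C Y : 𝒞) : Set (RightClass Y) :=
  {c | ∃ (W : 𝒞) (f : W ⟶ Y), RightDetermined C f ∧ rightClass f = c}

end Classes

/-! ### Linear bifunctors, stable and costable categories -/

/-- A `k`-bilinear bifunctor `𝔼 : 𝒞ᵒᵖ × 𝒞 → Mod k`. -/
structure ExtBifunctor (k : Type uk) [CommRing k] (𝒞 : Type u) [Category.{v} 𝒞]
    [Preadditive 𝒞] [Linear k 𝒞] where
  /-- the underlying bifunctor -/
  F : 𝒞ᵒᵖ ⥤ 𝒞 ⥤ ModuleCat.{w} k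
  map_add_right : ∀ (C : 𝒞) {A A' : 𝒞} (a b : A ⟶ A'),
    (F.obj (op C)).map (a + b) = (F.obj (op C)).map a + (F.obj (op C)).map b
  map_smul_right : ∀ (C : 𝒞) {A A' : 𝒞} (r : k) (a : A ⟶ A'),
    (F.obj (op C)).map (r • a) = r • (F.obj (op C)).map a
  map_add_left : ∀ (A : 𝒞) {C C' : 𝒞} (c d : C' ⟶ C),
    (F.map (c + d).op).app A = (F.map c.op).app A + (F.map d.op).app A
  map_smul_left : ∀ (A : 𝒞) {C C' : 𝒞} (r : k) (c : C' ⟶ C),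
    (F.map (r • c).op).app A = r • (F.map c.op).app A

namespace ExtBifunctor

variable {k : Type uk} [CommRing k] {𝒞 : Type u} [Category.{v} 𝒞] [Preadditive 𝒞] [Linear k 𝒞]
variable (E : ExtBifunctor.{w} k 𝒞)

/-- The `k`-module `𝔼(C, A)`. -/
abbrev Ext (C A : 𝒞) : Type w := ((E.F.obj (op C)).obj A : ModuleCat.{w} k)

/-- `δ ↦ a_* δ`. -/
def push (C : 𝒞) {A A' : 𝒞} (a : A ⟶ A') : E.Ext C A →ₗ[k] E.Ext C A' :=
  ((E.F.obj (op C)).map a).hom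

/-- `δ ↦ c^* δ`. -/
def pull {C C' : 𝒞} (c : C' ⟶ C) (A : 𝒞) : E.Ext C A →ₗ[k] E.Ext C' A :=
  ((E.F.map c.op).app A).hom

lemma push_id (C A : 𝒞) (δ : E.Ext C A) : E.push C (𝟙 A) δ = δ := by
  simp [push]

lemma push_comp (C : 𝒞) {A A' A'' : 𝒞} (a : A ⟶ A') (b : A' ⟶ A'') (δ : E.Ext C A) :
    E.push C (a ≫ b) δ = E.push C b (E.push C a δ) := by
  simp [push]

lemma push_add (C : 𝒞) {A A' : 𝒞} (a b : A ⟶ A') (δ : E.Ext C A) :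
    E.push C (a + b) δ = E.push C a δ + E.push C b δ := by
  simp [push, E.map_add_right]

lemma push_smul (C : 𝒞) {A A' : 𝒞} (r : k) (a : A ⟶ A') (δ : E.Ext C A) :
    E.push C (r • a) δ = r • E.push C a δ := by
  simp [push, E.map_smul_right]

lemma push_zero (C A A' : 𝒞) (δ : E.Ext C A) : E.push C (0 : A ⟶ A') δ = 0 := by
  have h := E.push_smul C (0 : k) (0 : A ⟶ A') δ
  rwa [zero_smul, zero_smul] at h

lemma pull_id (C A : 𝒞) (δ : E.Ext C A) : E.pull (𝟙 C) A δ = δ := by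
  simp [pull]

lemma pull_comp {C C' C'' : 𝒞} (c : C' ⟶ C) (d : C'' ⟶ C') (A : 𝒞) (δ : E.Ext C A) :
    E.pull (d ≫ c) A δ = E.pull d A (E.pull c A δ) := by
  simp [pull]

lemma pull_add {C C' : 𝒞} (c d : C' ⟶ C) (A : 𝒞) (δ : E.Ext C A) :
    E.pull (c + d) A δ = E.pull c A δ + E.pull d A δ := by
  unfold pull
  rw [E.map_add_left]
  rfl

lemma pull_smul {C C' : 𝒞} (r : k) (c : C' ⟶ C) (A : 𝒞) (δ : E.Ext C A) :
    E.pull (r • c) A δ = r • E.pull c A δ := by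
  unfold pull
  rw [E.map_smul_left]
  rfl

lemma push_pull {C C' A A' : 𝒞} (c : C' ⟶ C) (a : A ⟶ A') (δ : E.Ext C A) :
    E.push C' a (E.pull c A δ) = E.pull c A' (E.push C a δ) := by
  have h := (E.F.map c.op).naturality a
  exact (LinearMap.congr_fun (congrArg ModuleCat.Hom.hom h) δ).symm

/-- `𝔼(C, A)` as a left `End A`-module, `a • δ = a_* δ`. -/
instance endModule (C A : 𝒞) : Module (End A) (E.Ext C A) where
  smul a δ := E.push C a δ
  one_smul δ := E.push_id C A δ
  mul_smul a b δ := E.push_comp C b a δ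
  smul_zero a := (E.push C a).map_zero
  smul_add a := (E.push C a).map_add
  add_smul a b δ := E.push_add C a b δ
  zero_smul δ := E.push_zero C A A δ

/-- The map `δ^♯_X : 𝒞(A, X) → 𝔼(C, X)`, `g ↦ g_* δ`, of left `End X`-modules. -/
def sharp {C A : 𝒞} (δ : E.Ext C A) (X : 𝒞) : (A ⟶ X) →ₗ[End X] E.Ext C X where
  toFun g := E.push C g δ
  map_add' f g := E.push_add C f g δ
  map_smul' a g := E.push_comp C g a δ

/-- `f` is projectively trivial: `f^* : 𝔼(Y, Z) → 𝔼(X, Z)` vanishes for all `Z`. -/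
def ProjTrivial {X Y : 𝒞} (f : X ⟶ Y) : Prop :=
  ∀ (Z : 𝒞) (δ : E.Ext Y Z), E.pull f Z δ = 0

/-- `g` is injectively trivial: `g_* : 𝔼(Z, X) → 𝔼(Z, Y)` vanishes for all `Z`. -/
def InjTrivial {X Y : 𝒞} (g : X ⟶ Y) : Prop :=
  ∀ (Z : 𝒞) (δ : E.Ext Z X), E.push Z g δ = 0

variable {E} in
lemma projTrivial_sub_iff {X Y : 𝒞} (f g : X ⟶ Y) :
    E.ProjTrivial (f - g) ↔ ∀ (Z : 𝒞) (δ : E.Ext Y Z), E.pull f Z δ = E.pull g Z δ := by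
  refine forall₂_congr fun Z δ => ?_
  have h := E.pull_add (f - g) g Z δ
  rw [sub_add_cancel] at h
  rw [h, add_eq_right]

variable {E} in
lemma injTrivial_sub_iff {X Y : 𝒞} (f g : X ⟶ Y) :
    E.InjTrivial (f - g) ↔ ∀ (Z : 𝒞) (δ : E.Ext Z X), E.push Z f δ = E.push Z g δ := by
  refine forall₂_congr fun Z δ => ?_
  have h := E.push_add Z (f - g) g δ
  rw [sub_add_cancel] at h
  rw [h, add_eq_right]

/-- Equality of morphisms modulo projectively trivial ones. -/
def stableRel : HomRel 𝒞 := fun _ _ f g => E.ProjTrivial (f - g)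

/-- Equality of morphisms modulo injectively trivial ones. -/
def costableRel : HomRel 𝒞 := fun _ _ f g => E.InjTrivial (f - g)

instance : Congruence E.stableRel where
  comp_left f g g' h := (projTrivial_sub_iff _ _).2 fun Z δ => by
    rw [pull_comp, pull_comp, (projTrivial_sub_iff _ _).1 h]
  comp_right g h := (projTrivial_sub_iff _ _).2 fun Z δ => by
    rw [pull_comp, pull_comp, (projTrivial_sub_iff _ _).1 h]
  equivalence :=
    { refl := fun f => (projTrivial_sub_iff _ _).2 fun _ _ => rfl
      symm := fun h => (projTrivial_sub_iff _ _).2 fun Z δ =>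
        ((projTrivial_sub_iff _ _).1 h Z δ).symm
      trans := fun h h' => (projTrivial_sub_iff _ _).2 fun Z δ =>
        ((projTrivial_sub_iff _ _).1 h Z δ).trans ((projTrivial_sub_iff _ _).1 h' Z δ) }

instance : Congruence E.costableRel where
  comp_left f g g' h := (injTrivial_sub_iff _ _).2 fun Z δ => by
    rw [push_comp, push_comp, (injTrivial_sub_iff _ _).1 h]
  comp_right g h := (injTrivial_sub_iff _ _).2 fun Z δ => by
    rw [push_comp, push_comp, (injTrivial_sub_iff _ _).1 h]
  equivalence :=
    { refl := fun f => (injTrivial_sub_iff _ _).2 fun _ _ => rfl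
      symm := fun h => (injTrivial_sub_iff _ _).2 fun Z δ =>
        ((injTrivial_sub_iff _ _).1 h Z δ).symm
      trans := fun h h' => (injTrivial_sub_iff _ _).2 fun Z δ =>
        ((injTrivial_sub_iff _ _).1 h Z δ).trans ((injTrivial_sub_iff _ _).1 h' Z δ) }

lemma stableRel_add ⦃X Y : 𝒞⦄ (f₁ f₂ g₁ g₂ : X ⟶ Y) (hf : E.stableRel f₁ f₂)
    (hg : E.stableRel g₁ g₂) : E.stableRel (f₁ + g₁) (f₂ + g₂) :=
  (projTrivial_sub_iff _ _).2 fun Z δ => by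
    rw [pull_add, pull_add, (projTrivial_sub_iff _ _).1 hf, (projTrivial_sub_iff _ _).1 hg]

lemma costableRel_add ⦃X Y : 𝒞⦄ (f₁ f₂ g₁ g₂ : X ⟶ Y) (hf : E.costableRel f₁ f₂)
    (hg : E.costableRel g₁ g₂) : E.costableRel (f₁ + g₁) (f₂ + g₂) :=
  (injTrivial_sub_iff _ _).2 fun Z δ => by
    rw [push_add, push_add, (injTrivial_sub_iff _ _).1 hf, (injTrivial_sub_iff _ _).1 hg]

lemma stableRel_smul (r : k) ⦃X Y : 𝒞⦄ (f g : X ⟶ Y) (h : E.stableRel f g) :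
    E.stableRel (r • f) (r • g) :=
  (projTrivial_sub_iff _ _).2 fun Z δ => by
    rw [pull_smul, pull_smul, (projTrivial_sub_iff _ _).1 h]

lemma costableRel_smul (r : k) ⦃X Y : 𝒞⦄ (f g : X ⟶ Y) (h : E.costableRel f g) :
    E.costableRel (r • f) (r • g) :=
  (injTrivial_sub_iff _ _).2 fun Z δ => by
    rw [push_smul, push_smul, (injTrivial_sub_iff _ _).1 h]

/-- The stable category: morphisms modulo projectively trivial ones. -/
abbrev Stable := CategoryTheory.Quotient E.stableRel

/-- The costable category: morphisms modulo injectively trivial ones. -/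
abbrev Costable := CategoryTheory.Quotient E.costableRel

instance : Preadditive E.Stable := Quotient.preadditive _ E.stableRel_add

instance : Preadditive E.Costable := Quotient.preadditive _ E.costableRel_add

/-- The projection of `𝒞` onto its stable category, `f ↦ f̲`. -/
abbrev toStable : 𝒞 ⥤ E.Stable := Quotient.functor E.stableRel

/-- The projection of `𝒞` onto its costable category, `f ↦ f̄`. -/
abbrev toCostable : 𝒞 ⥤ E.Costable := Quotient.functor E.costableRel

instance : E.toStable.Additive := Quotient.functor_additive _ E.stableRel_add

instance : E.toCostable.Additive := Quotient.functor_additive _ E.costableRel_add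

instance : Linear k E.Stable := Quotient.linear k _ E.stableRel_smul

instance : Linear k E.Costable := Quotient.linear k _ E.costableRel_smul

/-- The stable Hom space `𝒞̲(C, Y)`. -/
abbrev StableHom (C Y : 𝒞) := E.toStable.obj C ⟶ E.toStable.obj Y

/-- The costable Hom space `𝒞̄(C, Y)`. -/
abbrev CostableHom (C Y : 𝒞) := E.toCostable.obj C ⟶ E.toCostable.obj Y

/-- The stable Hom space `𝒞̲(C, Y)` as a module over the opposite of `End C`, which acts by
precomposition. -/
instance stableModule (C Y : 𝒞) : Module (End C)ᵐᵒᵖ (E.StableHom C Y) where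
  smul a h := E.toStable.map (MulOpposite.unop a) ≫ h
  one_smul h := by
    change E.toStable.map (𝟙 C) ≫ h = h
    rw [E.toStable.map_id, Category.id_comp]
  mul_smul a b h := by
    change E.toStable.map (MulOpposite.unop a ≫ MulOpposite.unop b) ≫ h = _
    rw [Functor.map_comp, Category.assoc]
    rfl
  smul_zero a := comp_zero
  smul_add a f g := Preadditive.comp_add _ _ _ _ _ _
  add_smul a b h := by
    change E.toStable.map (MulOpposite.unop a + MulOpposite.unop b) ≫ h = _
    rw [Functor.map_add, Preadditive.add_comp]
    rfl
  zero_smul h := by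
    change E.toStable.map (0 : C ⟶ C) ≫ h = 0
    rw [Functor.map_zero, zero_comp]

/-- The map `𝒞̲(C, f) : 𝒞̲(C, W) → 𝒞̲(C, Y)`. -/
def stablePostcomp (C : 𝒞) {W Y : 𝒞} (f : W ⟶ Y) :
    E.StableHom C W →ₗ[(End C)ᵐᵒᵖ] E.StableHom C Y where
  toFun h := h ≫ E.toStable.map f
  map_add' _ _ := Preadditive.add_comp _ _ _ _ _ _
  map_smul' _ _ := Category.assoc _ _ _

/-- The map `η_{C,Y}` on right equivalence classes, `[f⟩ ↦ Im 𝒞̲(C, f)`. -/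
def eta (C Y : 𝒞) : RightClass Y → Submodule (End C)ᵐᵒᵖ (E.StableHom C Y) :=
  Quotient.lift (fun f : MorTo Y => LinearMap.range (E.stablePostcomp C f.hom)) <| by
    have key : ∀ f g : MorTo Y, f ≤ g → LinearMap.range (E.stablePostcomp C f.hom) ≤
        LinearMap.range (E.stablePostcomp C g.hom) := by
      rintro f g ⟨v, hv⟩ _ ⟨h, rfl⟩
      refine ⟨h ≫ E.toStable.map v, ?_⟩
      change (h ≫ E.toStable.map v) ≫ E.toStable.map g.hom = h ≫ E.toStable.map f.hom
      rw [Category.assoc, ← Functor.map_comp, hv]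
    exact fun f g h => le_antisymm (key f g h.1) (key g f h.2)

/-- `𝔼(C, A)` is a finitely generated `k`-module for all `C` and `A`. -/
def ExtFinite : Prop := ∀ C A : 𝒞, Module.Finite k (E.Ext C A)

/-! ### Auslander-Reiten-Serre duality -/

/-- An Auslander-Reiten-Serre duality: a `k`-linear equivalence `τ` from the stable to the costable
category with a chosen quasi-inverse (and unit and counit), and `k`-linear isomorphisms
`Φ : Hom_k(𝔼(X, Y), J) ≃ 𝒞̄(Y, τ X)`, natural in `X` and `Y`. -/
structure ARSDuality (J : Type uk) [AddCommGroup J] [Module k J] where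
  /-- the equivalence `τ` with its quasi-inverse `τ⁻` -/
  tau : E.Stable ≌ E.Costable
  additive : tau.functor.Additive
  linear : tau.functor.Linear k
  /-- the isomorphisms `Φ_{X,Y}` -/
  Phi : ∀ X Y : 𝒞,
    (E.Ext X Y →ₗ[k] J) ≃ₗ[k] (E.toCostable.obj Y ⟶ tau.functor.obj (E.toStable.obj X))
  natural : ∀ {X X' Y Y' : 𝒞} (x : X ⟶ X') (y : Y' ⟶ Y) (φ : E.Ext X Y →ₗ[k] J),
    Phi X' Y' (φ ∘ₗ E.pull x Y ∘ₗ E.push X' y) =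
      E.toCostable.map y ≫ Phi X Y φ ≫ tau.functor.map (E.toStable.map x)

namespace ARSDuality

variable {E} {J : Type uk} [AddCommGroup J] [Module k J] (D : E.ARSDuality J)

/-- The object `τ⁻ X`. -/
def tauInv (X : 𝒞) : 𝒞 := (D.tau.inverse.obj (E.toCostable.obj X)).as

/-- The isomorphism `ϑ_{X,Y} : 𝒞̄(Y, τ X) ≃ 𝒞̲(τ⁻ Y, X)`, which sends `f` to `τ⁻ f` followed by the
counit `θ_X : τ⁻ τ X → X`. -/
def vartheta (X Y : 𝒞) :
    (E.toCostable.obj Y ⟶ D.tau.functor.obj (E.toStable.obj X)) ≃ₗ[k]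
      (D.tau.inverse.obj (E.toCostable.obj Y) ⟶ E.toStable.obj X) where
  toFun f := D.tau.inverse.map f ≫ D.tau.unitIso.inv.app (E.toStable.obj X)
  map_add' f g := by
    have := D.additive
    rw [D.tau.inverse.map_add, Preadditive.add_comp]
  map_smul' r f := by
    have := D.additive
    have := D.linear
    rw [D.tau.inverse.map_smul, Linear.smul_comp]
    rfl
  invFun h := D.tau.counitIso.inv.app (E.toCostable.obj Y) ≫ D.tau.functor.map h
  left_inv f := by
    have h := (D.tau.symm.toAdjunction.homEquiv (E.toCostable.obj Y)
      (E.toStable.obj X)).apply_symm_apply f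
    rwa [Adjunction.homEquiv_unit, Adjunction.homEquiv_counit] at h
  right_inv f := by
    have h := (D.tau.symm.toAdjunction.homEquiv (E.toCostable.obj Y)
      (E.toStable.obj X)).symm_apply_apply f
    rwa [Adjunction.homEquiv_unit, Adjunction.homEquiv_counit] at h

/-- The isomorphism `Ψ_{X,Y} : Hom_k(𝔼(X, Y), J) ≃ 𝒞̲(τ⁻ Y, X)`, the composite of `Φ_{X,Y}` and
`ϑ_{X,Y}`. -/
def Psi (X Y : 𝒞) : (E.Ext X Y →ₗ[k] J) ≃ₗ[k] E.StableHom (D.tauInv Y) X :=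
  (D.Phi X Y).trans (D.vartheta X Y)

lemma Psi_push (X Y : 𝒞) (a : End X) (t : End (D.tauInv X))
    (hat : D.tau.inverse.map (E.toCostable.map a) = E.toStable.map t)
    (φ : E.Ext Y X →ₗ[k] J) :
    D.Psi Y X (φ ∘ₗ E.push Y a) = MulOpposite.op t • D.Psi Y X φ := by
  have h := D.natural (𝟙 Y) a φ
  have h1 : φ ∘ₗ E.pull (𝟙 Y) X ∘ₗ E.push Y a = φ ∘ₗ E.push Y a := by
    ext δ
    simp [E.pull_id]
  rw [h1, E.toStable.map_id, D.tau.functor.map_id, Category.comp_id] at h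
  have h2 : D.vartheta Y X (D.Phi Y X (φ ∘ₗ E.push Y a)) =
      D.tau.inverse.map (E.toCostable.map a) ≫ D.vartheta Y X (D.Phi Y X φ) := by
    rw [h]
    change D.tau.inverse.map (E.toCostable.map a ≫ D.Phi Y X φ) ≫ _ =
      _ ≫ D.tau.inverse.map (D.Phi Y X φ) ≫ _
    rw [D.tau.inverse.map_comp, Category.assoc]
  rw [hat] at h2
  exact h2

/-- `Υ_{X,Y}(F)`, the kernel of the map `𝒞̲(τ⁻ X, Y) → Hom_k(F, J)` sending `h` to the restriction
of `Ψ_{Y,X}⁻¹(h)` to `F`. -/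
def upsilon {X Y : 𝒞} (F : Submodule (End X) (E.Ext Y X)) :
    Submodule (End (D.tauInv X))ᵐᵒᵖ (E.StableHom (D.tauInv X) Y) where
  carrier := {h | ∀ δ ∈ F, (D.Psi Y X).symm h δ = 0}
  zero_mem' δ _ := by rw [map_zero, LinearMap.zero_apply]
  add_mem' hf hg δ hδ := by
    rw [map_add, LinearMap.add_apply, hf δ hδ, hg δ hδ, add_zero]
  smul_mem' t h hh δ hδ := by
    obtain ⟨b, hb⟩ := D.tau.inverse.map_surjective (E.toStable.map (MulOpposite.unop t))
    obtain ⟨a, rfl⟩ := E.toCostable.map_surjective b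
    have key := D.Psi_push X Y a (MulOpposite.unop t) hb ((D.Psi Y X).symm h)
    rw [LinearEquiv.apply_symm_apply, MulOpposite.op_unop] at key
    rw [← key, LinearEquiv.symm_apply_apply]
    exact hh _ (F.smul_mem (a : End X) hδ)

end ARSDuality
end ExtBifunctor

/-! ### Complexes with prescribed end terms -/

section Complexes

variable {𝒞 : Type u} [Category.{v} 𝒞] [Preadditive 𝒞]

/-- A complex `X₀ → X₁ → ⋯ → Xₙ₊₁`, zero in all other degrees, with first term `A` and last
term `C`. The end terms are identified with `A` and `C` by given isomorphisms. -/
structure EndComplex (n : ℕ) (A C : 𝒞) where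
  /-- the complex -/
  K : CochainComplex 𝒞 ℕ
  isZero : ∀ i, n + 1 < i → IsZero (K.X i)
  /-- the identification of the first term -/
  left : A ≅ K.X 0
  /-- the identification of the last term -/
  right : K.X (n + 1) ≅ C

namespace EndComplex

variable {n : ℕ} {A A' C C' : 𝒞}

/-- The first differential `A → X₁`. -/
def dFirst (X : EndComplex n A C) : A ⟶ X.K.X 1 := X.left.hom ≫ X.K.d 0 1

/-- The last differential `Xₙ → C`. -/
def dLast (X : EndComplex n A C) : X.K.X n ⟶ C := X.K.d n (n + 1) ≫ X.right.hom

/-- The morphism of complexes `f` is `a` on the first terms and `c` on the last terms. -/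
def Extends (X : EndComplex n A C) (Y : EndComplex n A' C') (f : X.K ⟶ Y.K) (a : A ⟶ A')
    (c : C ⟶ C') : Prop :=
  X.left.hom ≫ f.f 0 = a ≫ Y.left.hom ∧ f.f (n + 1) ≫ Y.right.hom = X.right.hom ≫ c

/-- Homotopy equivalence of complexes with end terms `A` and `C`, through morphisms that are the
identity on the end terms. -/
instance setoid (n : ℕ) (A C : 𝒞) : Setoid (EndComplex n A C) where
  r X Y := ∃ e : HomotopyEquiv X.K Y.K,
    X.Extends Y e.hom (𝟙 A) (𝟙 C) ∧ Y.Extends X e.inv (𝟙 A) (𝟙 C)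
  iseqv :=
    { refl := fun X => ⟨HomotopyEquiv.refl _, by simp [Extends], by simp [Extends]⟩
      symm := fun ⟨e, h, h'⟩ => ⟨e.symm, h', h⟩
      trans := by
        rintro X Y Z ⟨e, h, h'⟩ ⟨g, l, l'⟩
        refine ⟨e.trans g, ?_, ?_⟩
        · simp only [Extends, Category.id_comp, Category.comp_id] at h l ⊢
          simp [reassoc_of% h.1, l.1, l.2, h.2]
        · simp only [Extends, Category.id_comp, Category.comp_id] at h' l' ⊢
          simp [reassoc_of% l'.1, h'.1, h'.2, l'.2] }

variable [HasFiniteBiproducts 𝒞]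

/-- For a morphism `f : X → Y` that is the identity on the first terms, `M` is the mapping cone
`X₁ → X₂ ⊞ Y₁ → ⋯ → Xₙ₊₁ ⊞ Yₙ → Yₙ₊₁` of `f`. -/
structure MappingCone {X : EndComplex n A C} {Y : EndComplex n A C'} (f : X.K ⟶ Y.K)
    (M : EndComplex n (X.K.X 1) C') where
  /-- the identification of the inner terms -/
  iso : ∀ i, 1 ≤ i → i ≤ n → (X.K.X (i + 1) ⊞ Y.K.X i ≅ M.K.X i)
  first : ∀ h : 1 ≤ n,
    M.dFirst = biprod.lift (-X.K.d 1 2) (f.f 1) ≫ (iso 1 le_rfl h).hom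
  inner : ∀ i (h : 1 ≤ i) (h' : i + 1 ≤ n),
    (iso i h (by omega)).hom ≫ M.K.d i (i + 1) =
      biprod.lift (-(biprod.fst ≫ X.K.d (i + 1) (i + 2)))
        (biprod.fst ≫ f.f (i + 1) + biprod.snd ≫ Y.K.d i (i + 1)) ≫
      (iso (i + 1) (by omega) h').hom
  last : ∀ h : 1 ≤ n,
    (iso n h le_rfl).hom ≫ M.dLast = biprod.desc (f.f (n + 1) ≫ Y.right.hom) Y.dLast

/-- For a morphism `f : X → Y` that is the identity on the last terms, `N` is the mapping cocone
`X₀ → X₁ ⊞ Y₀ → ⋯ → Xₙ ⊞ Yₙ₋₁ → Yₙ` of `f`. The signs are those obtained by forming the mapping cone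
in the opposite category. -/
structure MappingCocone {X : EndComplex n A C} {Y : EndComplex n A' C} (f : X.K ⟶ Y.K)
    (N : EndComplex n A (Y.K.X n)) where
  /-- the identification of the inner terms, `j = i - 1` -/
  iso : ∀ i j, j + 1 = i → i ≤ n → (X.K.X i ⊞ Y.K.X j ≅ N.K.X i)
  first : ∀ h : 1 ≤ n,
    N.dFirst = biprod.lift X.dFirst (X.left.hom ≫ f.f 0) ≫ (iso 1 0 rfl h).hom
  inner : ∀ i j (h : j + 1 = i) (h' : i + 1 ≤ n),
    (iso i j h (by omega)).hom ≫ N.K.d i (i + 1) =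
      biprod.lift (biprod.fst ≫ X.K.d i (i + 1))
        (biprod.fst ≫ f.f i - biprod.snd ≫ Y.K.d j i) ≫
      (iso (i + 1) i rfl h').hom
  last : ∀ j (h : j + 1 = n),
    (iso n j h le_rfl).hom ≫ N.dLast = biprod.desc (f.f n) (-Y.K.d j n)

end EndComplex
end Complexes

/-! ### `n`-exangulated categories -/

section Exangulated

variable {k : Type uk} [CommRing k] {𝒞 : Type u} [Category.{v} 𝒞] [Preadditive 𝒞] [Linear k 𝒞]

/-- `⟨X, δ⟩` is an `n`-exangle: the sequences
`𝒞(-, X₀) → ⋯ → 𝒞(-, Xₙ₊₁) → 𝔼(-, X₀)` and `𝒞(Xₙ₊₁, -) → ⋯ → 𝒞(X₀, -) → 𝔼(Xₙ₊₁, -)` are exact,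
where `X₀ = A` and `Xₙ₊₁ = C`. -/
structure IsExangle (E : ExtBifunctor.{w} k 𝒞) {n : ℕ} {A C : 𝒞} (X : EndComplex n A C)
    (δ : E.Ext C A) : Prop where
  push_zero : E.push C X.dFirst δ = 0
  pull_zero : E.pull X.dLast A δ = 0
  exact_to : ∀ (Z : 𝒞) (i : ℕ), i < n →
    Function.Exact (fun g : Z ⟶ X.K.X i => g ≫ X.K.d i (i + 1))
      (fun g : Z ⟶ X.K.X (i + 1) => g ≫ X.K.d (i + 1) (i + 2))
  exact_to_last : ∀ Z : 𝒞,
    Function.Exact (fun g : Z ⟶ X.K.X n => g ≫ X.dLast) (fun g : Z ⟶ C => E.pull g A δ)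
  exact_from : ∀ (Z : 𝒞) (i : ℕ), i < n →
    Function.Exact (fun g : X.K.X (i + 2) ⟶ Z => X.K.d (i + 1) (i + 2) ≫ g)
      (fun g : X.K.X (i + 1) ⟶ Z => X.K.d i (i + 1) ≫ g)
  exact_from_first : ∀ Z : 𝒞,
    Function.Exact (fun g : X.K.X 1 ⟶ Z => X.dFirst ≫ g) (fun g : A ⟶ Z => E.push C g δ)

/-- A correspondence `𝔰` that assigns to every extension `δ ∈ 𝔼(C, A)` a homotopy equivalence class
of complexes with end terms `A` and `C`. -/
abbrev Correspondence (E : ExtBifunctor.{w} k 𝒞) (n : ℕ) :=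
  ∀ ⦃C A : 𝒞⦄, E.Ext C A → Quotient (EndComplex.setoid n A C)

namespace Correspondence

variable {E : ExtBifunctor.{w} k 𝒞} {n : ℕ} (s : Correspondence E n)

/-- `X` realizes `δ`, i.e. `𝔰(δ) = [X]`. -/
def Realizes {A C : 𝒞} (X : EndComplex n A C) (δ : E.Ext C A) : Prop := s δ = ⟦X⟧

/-- `f : A → B` is the first morphism of a complex that realizes some extension. -/
def IsInflation {A B : 𝒞} (f : A ⟶ B) : Prop :=
  ∃ (C : 𝒞) (δ : E.Ext C A) (X : EndComplex n A C),
    s.Realizes X δ ∧ ∃ b : X.K.X 1 ≅ B, X.dFirst ≫ b.hom = f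

/-- `f : W → Y` is the last morphism of a complex that realizes `δ`. -/
def IsLastOf {W Y A : 𝒞} (f : W ⟶ Y) (δ : E.Ext Y A) : Prop :=
  ∃ X : EndComplex n A Y, s.Realizes X δ ∧ ∃ b : W ≅ X.K.X n, b.hom ≫ X.dLast = f

/-- `f : W → Y` is the last morphism of a complex that realizes some extension. -/
def IsDeflation {W Y : 𝒞} (f : W ⟶ Y) : Prop :=
  ∃ (A : 𝒞) (δ : E.Ext Y A), s.IsLastOf f δ

end Correspondence

variable [HasFiniteBiproducts 𝒞]

/-- A structure of a `k`-linear `n`-exangulated category `(𝒞, 𝔼, 𝔰)` on `(𝒞, 𝔼)`. -/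
structure NExangulated (E : ExtBifunctor.{w} k 𝒞) (n : ℕ) where
  /-- the realization -/
  s : Correspondence E n
  /-- (R0) -/
  lift : ∀ {A C A' C' : 𝒞} (δ : E.Ext C A) (ρ : E.Ext C' A') (X : EndComplex n A C)
    (Y : EndComplex n A' C') (a : A ⟶ A') (c : C ⟶ C'),
    s.Realizes X δ → s.Realizes Y ρ → E.push C a δ = E.pull c A' ρ →
    ∃ f : X.K ⟶ Y.K, X.Extends Y f a c
  /-- (R1) -/
  exangle : ∀ {A C : 𝒞} (δ : E.Ext C A) (X : EndComplex n A C), s.Realizes X δ → IsExangle E X δ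
  /-- (R2): `0 ∈ 𝔼(0, A)` is realized by `A = A → 0 → ⋯ → 0` -/
  zero_right : ∀ A Z : 𝒞, IsZero Z → ∃ X : EndComplex n A Z,
    s.Realizes X (0 : E.Ext Z A) ∧ IsIso (X.K.d 0 1) ∧ ∀ i, 2 ≤ i → IsZero (X.K.X i)
  /-- (R2), dual: `0 ∈ 𝔼(A, 0)` is realized by `0 → ⋯ → 0 → A = A` -/
  zero_left : ∀ A Z : 𝒞, IsZero Z → ∃ X : EndComplex n Z A,
    s.Realizes X (0 : E.Ext A Z) ∧ IsIso (X.K.d n (n + 1)) ∧ ∀ i, i < n → IsZero (X.K.X i)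
  /-- (EA1) -/
  comp_inflation : ∀ {A B C : 𝒞} (f : A ⟶ B) (g : B ⟶ C),
    s.IsInflation f → s.IsInflation g → s.IsInflation (f ≫ g)
  /-- (EA1), dual -/
  comp_deflation : ∀ {A B C : 𝒞} (f : A ⟶ B) (g : B ⟶ C),
    s.IsDeflation f → s.IsDeflation g → s.IsDeflation (f ≫ g)
  /-- (EA2) -/
  good_lift : ∀ {A C D : 𝒞} (ρ : E.Ext D A) (c : C ⟶ D) (X : EndComplex n A C)
    (Y : EndComplex n A D), s.Realizes X (E.pull c A ρ) → s.Realizes Y ρ →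
    ∃ f : X.K ⟶ Y.K, X.Extends Y f (𝟙 A) c ∧
      ∃ M : EndComplex n (X.K.X 1) D, Nonempty (EndComplex.MappingCone f M) ∧
        s.Realizes M (E.push D X.dFirst ρ)
  /-- (EA2), dual -/
  good_colift : ∀ {A B C : 𝒞} (ρ : E.Ext C A) (a : A ⟶ B) (X : EndComplex n A C)
    (Y : EndComplex n B C), s.Realizes X ρ → s.Realizes Y (E.push C a ρ) →
    ∃ f : X.K ⟶ Y.K, X.Extends Y f a (𝟙 C) ∧
      ∃ N : EndComplex n A (Y.K.X n), Nonempty (EndComplex.MappingCocone f N) ∧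
        s.Realizes N (E.pull Y.dLast A ρ)

namespace NExangulated

variable {E : ExtBifunctor.{w} k 𝒞} {n : ℕ} (S : NExangulated E n)

/-- If `f ≫ g` is a deflation then so is `g`, and if `f ≫ g` is an inflation then so is `f`. -/
def WIC : Prop :=
  ∀ {A B C : 𝒞} (f : A ⟶ B) (g : B ⟶ C),
    (S.s.IsDeflation (f ≫ g) → S.s.IsDeflation g) ∧ (S.s.IsInflation (f ≫ g) → S.s.IsInflation f)

/-- `[→ Y⟩_def`, the classes of deflations to `Y`. -/
def deflationClasses (Y : 𝒞) : Set (RightClass Y) :=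
  {c | ∃ (W : 𝒞) (f : W ⟶ Y), S.s.IsDeflation f ∧ rightClass f = c}

/-- `^C[→ Y⟩_def`, the classes of deflations to `Y` that are right `C`-determined. -/
def determinedDeflationClasses (C Y : 𝒞) : Set (RightClass Y) :=
  S.deflationClasses Y ∩ determinedClasses C Y

/-- `_X[→ Y⟩_def`, the classes that contain the last morphism `f` of a distinguished `n`-exangle
`X₀ → X₁ → ⋯ → W → Y` with `X₀ ∈ add X`. -/
def addClasses (X Y : 𝒞) : Set (RightClass Y) :=
  {c | ∃ (W X₀ : 𝒞) (f : W ⟶ Y) (δ : E.Ext Y X₀),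
    InAdd X X₀ ∧ S.s.IsLastOf f δ ∧ rightClass f = c}

/-- The restricted Auslander bijection at `Y` relative to `C` holds: `η_{C,Y}` maps `^C[→ Y⟩_def`
onto the set of all `(End C)ᵒᵖ`-submodules of `𝒞̲(C, Y)`. -/
def RestrictedAuslanderBijection (C Y : 𝒞) : Prop :=
  Function.Surjective fun c : S.determinedDeflationClasses C Y => E.eta C Y c

end NExangulated
end Exangulated
end NExang

end

open NExang

noncomputable section

namespace NExang

attribute [local instance] hasBinaryBiproducts_of_finite_biproducts

/-! ### Duality with respect to a minimal injective cogenerator -/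

section Duality

/-! Everything rests on one computation. Let δ ∈ 𝔼(Y, A) be the extension of a deflation f : W → Y.
A morphism g to Y factors through f iff g^*δ = 0, and 𝒞(A, X) → 𝔼(Y, X) → 𝔼(W, X) is exact
(`pull_eq_zero_iff`). Under Ψ, composition with f becomes the dual of f^* : 𝔼(Y, X) → 𝔼(W, X). As J
is injective, the functionals that factor through f^* are those vanishing on its kernel {g_*δ}. So
Im 𝒞̲(τ⁻X, f) is the annihilator of {g_*δ} (`eta_eq_upsilon`), which is the commuting triangle.

Projectively trivial morphisms factor through every deflation, so Im 𝒞̲(C, f) records which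
morphisms C → Y factor through f. For right C-determined deflations this settles the order
(`eta_le_iff`), so η is an order embedding on determined classes. For surjectivity, the generators
of a finitely generated F ⊆ 𝔼(Y, X) are the components of one extension of X^m. The deflation it
yields is right τ⁻X-determined, because functionals to J detect nonzero elements of 𝔼(L, X), and its
image under η is Υ(F). Taking for F the annihilator of a given submodule H gives η = H, by the
double annihilator property. Taking F = {g_*δ} for a determined deflation gives an n-exangle
starting in add X with the same value of η, hence the same class.

Minimality of J enters through the double annihilator: the part of J killed by a maximal ideal is
cyclic, so dualizing does not increase length, and a length count closes the argument. The same
bound makes all submodules of 𝒞̲(τ⁻X, Y) finitely generated. -/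

theorem exists_maximal_disjoint {α : Type*} [CompleteLattice α] [IsCompactlyGenerated α]
    {a b : α} (h : Disjoint a b) : ∃ m, a ≤ m ∧ Maximal (fun x => Disjoint x b) m := by
  refine zorn_le_nonempty₀ {x | Disjoint x b} (fun c hc hch y hy => ?_) a h
  refine ⟨sSup c, ?_, fun z hz => le_sSup hz⟩
  -- In a compactly generated lattice, disjointness from b passes to directed suprema.
  exact hch.directedOn.disjoint_sSup_left.2 fun x hx => hc hx

variable {k : Type uk} [CommRing k]

/-- In an injective module, disjoint submodules are separated by an idempotent. -/
theorem exists_idempotent_of_disjoint {Q : Type*} [AddCommGroup Q] [Module k Q]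
    (hQ : Module.Baer k Q) {S T : Submodule k Q} (h : Disjoint T S) :
    ∃ q : Q →ₗ[k] Q, (∀ x, q (q x) = q x) ∧ S ≤ LinearMap.range q ∧ T ≤ LinearMap.ker q := by
  obtain ⟨A, hTA, hA⟩ := exists_maximal_disjoint h
  obtain ⟨B, hSB, hB⟩ := exists_maximal_disjoint hA.prop.symm
  have hinj : Function.Injective (A.subtype.coprod B.subtype) := by
    rw [injective_iff_map_eq_zero]
    rintro ⟨a, b⟩ hab
    simp only [LinearMap.coprod_apply, Submodule.subtype_apply] at hab
    have hb : (b : Q) = 0 := Submodule.disjoint_def.1 hB.prop _ b.2 <| by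
      rw [← neg_eq_of_add_eq_zero_right hab]
      exact A.neg_mem a.2
    have ha : (a : Q) = 0 := by rwa [hb, add_zero] at hab
    exact Prod.ext (Subtype.ext ha) (Subtype.ext hb)
  -- The projection A ⊕ B → B extends to q on all of Q. Maximality of A will give q⁻¹(A) = A, and
  -- then maximality of B gives range q = B, so that q is idempotent.
  obtain ⟨q, hq⟩ := Module.Baer.extension_property hQ _ hinj (B.subtype ∘ₗ LinearMap.snd k A B)
  have hqA : ∀ a ∈ A, q a = 0 := fun a ha => by
    simpa using LinearMap.congr_fun hq (⟨a, ha⟩, 0)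
  have hqB : ∀ b ∈ B, q b = b := fun b hb => by
    simpa using LinearMap.congr_fun hq (0, ⟨b, hb⟩)
  have hcomap : A.comap q ≤ A := by
    refine hA.le_of_ge (Submodule.disjoint_def.2 fun x hx hxS => ?_) fun a ha => ?_
    · rw [Submodule.mem_comap, hqB x (hSB hxS)] at hx
      exact Submodule.disjoint_def.1 hA.prop x hx hxS
    · rw [Submodule.mem_comap, hqA a ha]
      exact A.zero_mem
  have hBr : B ≤ LinearMap.range q := fun b hb => ⟨b, hqB b hb⟩
  have hrB : LinearMap.range q ≤ B := by
    refine hB.le_of_ge (Submodule.disjoint_def.2 ?_) hBr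
    rintro _ ⟨x, rfl⟩ hx
    exact hqA x (hcomap hx)
  exact ⟨q, fun x => hqB _ (hrB ⟨x, rfl⟩), hSB.trans hBr, fun x hx => hqA x (hTA hx)⟩

theorem baer_range_of_idempotent {Q : Type*} [AddCommGroup Q] [Module k Q]
    (hQ : Module.Baer k Q) (q : Q →ₗ[k] Q) (hq : ∀ x, q (q x) = q x) :
    Module.Baer k (LinearMap.range q) := by
  intro I g
  obtain ⟨g', hg'⟩ := hQ I ((LinearMap.range q).subtype ∘ₗ g)
  refine ⟨q.rangeRestrict ∘ₗ g', fun x hx => Subtype.ext ?_⟩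
  change q (g' x) = g ⟨x, hx⟩
  rw [hg' x hx]
  obtain ⟨y, hy⟩ := (g ⟨x, hx⟩).2
  change q (g ⟨x, hx⟩ : Q) = _
  rw [← hy, hq]

/-- A homomorphism from a cyclic submodule of `M` to an injective module extends to `M`. -/
theorem exists_linearMap_apply_eq {Q : Type*} [AddCommGroup Q] [Module k Q]
    (hQ : Module.Baer k Q) {M : Type*} [AddCommGroup M] [Module k M] (m : M) (x : Q)
    (h : ∀ r : k, r • m = 0 → r • x = 0) : ∃ φ : M →ₗ[k] Q, φ m = x := by
  let I : Ideal k := LinearMap.ker (LinearMap.toSpanSingleton k M m)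
  obtain ⟨φ, hφ⟩ := Module.Baer.extension_property hQ
    (I.liftQ (LinearMap.toSpanSingleton k M m) le_rfl)
    (LinearMap.ker_eq_bot.1 (Submodule.ker_liftQ_eq_bot _ _ _ le_rfl))
    (I.liftQ (LinearMap.toSpanSingleton k Q x) fun r hr => h r hr)
  refine ⟨φ, ?_⟩
  have h1 : φ ((1 : k) • m) = (1 : k) • x := LinearMap.congr_fun hφ (Submodule.Quotient.mk 1)
  rwa [one_smul, one_smul] at h1

variable {J : Type uk} [AddCommGroup J] [Module k J]

theorem IsInjectiveCogenerator.baer (hJ : IsInjectiveCogenerator k J) : Module.Baer k J :=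
  Module.Baer.of_injective hJ.1

/-- Frees the cogenerator property from the universe of k: it is applied to k ⧸ ann(m), and the
resulting functional on k·m is extended by injectivity. -/
theorem IsInjectiveCogenerator.exists_ne_zero (hJ : IsInjectiveCogenerator k J)
    {M : Type*} [AddCommGroup M] [Module k M] {m : M} (hm : m ≠ 0) :
    ∃ φ : M →ₗ[k] J, φ m ≠ 0 := by
  let I : Ideal k := LinearMap.ker (LinearMap.toSpanSingleton k M m)
  have h1 : (Submodule.Quotient.mk 1 : k ⧸ I) ≠ 0 := by
    rw [Ne, Submodule.Quotient.mk_eq_zero, LinearMap.mem_ker]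
    simpa using hm
  obtain ⟨ψ, hψ⟩ := hJ.2 (k ⧸ I) _ h1
  obtain ⟨φ, hφ⟩ := exists_linearMap_apply_eq hJ.baer m (ψ (Submodule.Quotient.mk 1)) fun r hr => by
    rw [← map_smul, ← Submodule.Quotient.mk_smul, (Submodule.Quotient.mk_eq_zero I).2, map_zero]
    simpa [I] using hr
  exact ⟨φ, hφ ▸ hψ⟩

/-- The annihilator of m ≠ 0 lies in a maximal ideal 𝔪, so m ↦ x is well defined on k·m for any x
killed by 𝔪, and it extends by injectivity. -/
theorem IsInjectiveCogenerator.of_forall_isMaximal (hJ : Module.Baer k J)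
    (h : ∀ 𝔪 : Ideal k, 𝔪.IsMaximal → ∃ x : J, x ≠ 0 ∧ ∀ r ∈ 𝔪, r • x = 0) :
    IsInjectiveCogenerator k J := by
  refine ⟨hJ.injective, fun M _ _ m hm => ?_⟩
  have hI : LinearMap.ker (LinearMap.toSpanSingleton k M m) ≠ ⊤ := fun hI => hm <| by
    have h1 : (1 : k) • m = 0 := LinearMap.mem_ker.1 (hI ▸ Submodule.mem_top : (1 : k) ∈ _)
    rwa [one_smul] at h1
  obtain ⟨𝔪, h𝔪, hle⟩ := Ideal.exists_le_maximal _ hI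
  obtain ⟨x, hx, hx'⟩ := h 𝔪 h𝔪
  obtain ⟨φ, hφ⟩ := exists_linearMap_apply_eq hJ m x fun r hr => hx' r (hle (by simpa using hr))
  exact ⟨φ, hφ ▸ hx⟩

/-- The `𝔪`-torsion of a minimal injective cogenerator is cyclic. -/
theorem IsMinimalInjectiveCogenerator.exists_generator (hJ : IsMinimalInjectiveCogenerator k J)
    (𝔪 : Ideal k) (h𝔪 : 𝔪.IsMaximal) :
    ∃ x : J, (∀ r ∈ 𝔪, r • x = 0) ∧ ∀ y : J, (∀ r ∈ 𝔪, r • y = 0) → ∃ a : k, y = a • x := by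
  have hex : ∀ 𝔫 : MaximalSpectrum k, ∃ x : J, x ≠ 0 ∧ ∀ r ∈ 𝔫.asIdeal, r • x = 0 := by
    intro 𝔫
    have h1 : (Submodule.Quotient.mk 1 : k ⧸ 𝔫.asIdeal) ≠ 0 := by
      rw [Ne, Submodule.Quotient.mk_eq_zero]
      exact (Ideal.ne_top_iff_one _).1 𝔫.isMaximal.ne_top
    obtain ⟨φ, hφ⟩ := hJ.1.2 _ _ h1
    refine ⟨_, hφ, fun r hr => ?_⟩
    rw [← map_smul, ← Submodule.Quotient.mk_smul, (Submodule.Quotient.mk_eq_zero _).2, map_zero]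
    simpa using hr
  choose x hx0 hx using hex
  let S : Submodule k J := Submodule.span k (Set.range x)
  -- S is essential in J: a direct summand containing S is injective and contains a copy of every k
  -- ⧸ 𝔫, so it is a cogenerator and minimality makes it all of J.
  have hess : ∀ T : Submodule k J, Disjoint T S → T = ⊥ := by
    intro T hT
    obtain ⟨q, hq, hSq, hTq⟩ := exists_idempotent_of_disjoint hJ.1.baer hT
    have htop := hJ.2 (LinearMap.range q) <|
      IsInjectiveCogenerator.of_forall_isMaximal (baer_range_of_idempotent hJ.1.baer q hq)
        fun 𝔫 h𝔫 => ⟨⟨x ⟨𝔫, h𝔫⟩, hSq (Submodule.subset_span ⟨_, rfl⟩)⟩,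
          fun h => hx0 _ (congrArg Subtype.val h), fun r hr => Subtype.ext (hx ⟨𝔫, h𝔫⟩ r hr)⟩
    refine (Submodule.eq_bot_iff _).2 fun t ht => ?_
    obtain ⟨y, rfl⟩ : t ∈ LinearMap.range q := htop ▸ Submodule.mem_top
    rw [← hq]
    exact hTq ht
  -- Away from 𝔪, S is generated by the single element attached to 𝔪: each other generator is killed
  -- by a scalar outside 𝔪, and the complement of 𝔪 is multiplicative.
  have hS : ∀ s ∈ S, ∃ e ∉ 𝔪, ∃ r : k, e • s = r • x ⟨𝔪, h𝔪⟩ := by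
    intro s hs
    induction hs using Submodule.span_induction with
    | mem s hs =>
      obtain ⟨𝔫, rfl⟩ := hs
      by_cases h : 𝔫.asIdeal ≤ 𝔪
      · obtain rfl : 𝔫 = ⟨𝔪, h𝔪⟩ := MaximalSpectrum.ext (𝔫.isMaximal.eq_of_le h𝔪.ne_top h)
        exact ⟨1, (Ideal.ne_top_iff_one _).1 h𝔪.ne_top, 1, rfl⟩
      · obtain ⟨e, he, he'⟩ := SetLike.not_le_iff_exists.1 h
        exact ⟨e, he', 0, by rw [hx 𝔫 e he, zero_smul]⟩
    | zero => exact ⟨1, (Ideal.ne_top_iff_one _).1 h𝔪.ne_top, 0, by simp⟩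
    | add s t _ _ hs ht =>
      obtain ⟨e, he, r, hr⟩ := hs
      obtain ⟨e', he', r', hr'⟩ := ht
      refine ⟨e * e', fun h => (h𝔪.isPrime.mem_or_mem h).elim he he', e' * r + e * r', ?_⟩
      rw [smul_add, add_smul, mul_smul e e' t, hr', mul_comm e e', mul_smul e' e s, hr,
        smul_smul, smul_smul]
    | smul a s _ hs =>
      obtain ⟨e, he, r, hr⟩ := hs
      exact ⟨e, he, a * r, by rw [smul_comm, hr, smul_smul]⟩
  refine ⟨x ⟨𝔪, h𝔪⟩, hx ⟨𝔪, h𝔪⟩, fun y hy => ?_⟩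
  -- The module k·y is a vector space over the field k ⧸ 𝔪, so scalars outside 𝔪 act on it
  -- invertibly.
  have hinv : ∀ e ∉ 𝔪, ∃ a : k, a • e • y = y := by
    intro e he
    obtain ⟨a, c, hc, hac⟩ := h𝔪.exists_inv he
    refine ⟨a, ?_⟩
    calc a • e • y = a • e • y + c • y := by rw [hy c hc, add_zero]
      _ = y := by rw [smul_smul, ← add_smul, hac, one_smul]
  rcases eq_or_ne y 0 with rfl | hy0
  · exact ⟨0, by simp⟩
  have hndisj : ¬ Disjoint (Submodule.span k {y}) S := fun h =>
    hy0 (Submodule.span_singleton_eq_bot.1 (hess _ h))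
  have hyS : y ∈ S := by
    rw [Submodule.disjoint_def] at hndisj
    push Not at hndisj
    obtain ⟨z, hz, hzS, hz0⟩ := hndisj
    obtain ⟨b, rfl⟩ := Submodule.mem_span_singleton.1 hz
    obtain ⟨a, ha⟩ := hinv b fun hb => hz0 (hy b hb)
    rw [← ha]
    exact S.smul_mem a hzS
  obtain ⟨e, he, r, hr⟩ := hS y hyS
  obtain ⟨a, ha⟩ := hinv e he
  exact ⟨a * r, by rw [mul_smul, ← hr, ha]⟩

/-- Evaluation at a generator m, whose annihilator 𝔪 is maximal, embeds the dual into the 𝔪-torsion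
of J, which is a quotient of k ⧸ 𝔪. -/
theorem IsMinimalInjectiveCogenerator.length_dual_le_one (hJ : IsMinimalInjectiveCogenerator k J)
    {M : Type*} [AddCommGroup M] [Module k M] [IsSimpleModule k M] :
    Module.length k (M →ₗ[k] J) ≤ 1 := by
  have := IsSimpleModule.nontrivial k M
  obtain ⟨m, hm⟩ := exists_ne (0 : M)
  have hmax : Ideal.IsMaximal (LinearMap.ker (LinearMap.toSpanSingleton k M m)) :=
    IsSimpleModule.ker_toSpanSingleton_isMaximal k hm
  obtain ⟨x, hx, hgen⟩ := hJ.exists_generator _ hmax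
  let e : (M →ₗ[k] J) →ₗ[k] Submodule.span k {x} :=
    LinearMap.codRestrict _ (LinearMap.applyₗ m) fun φ => by
      obtain ⟨a, ha⟩ := hgen (φ m) fun r hr => by
        have hrm : r • m = 0 := hr
        rw [← map_smul, hrm, map_zero]
      exact Submodule.mem_span_singleton.2 ⟨a, ha.symm⟩
  have he : Function.Injective e := by
    rw [injective_iff_map_eq_zero]
    intro φ hφ
    have h0 : φ m = 0 := congrArg Subtype.val hφ
    ext y
    obtain ⟨r, rfl⟩ := IsSimpleModule.toSpanSingleton_surjective k hm y
    simp [h0]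
  let p : (k ⧸ LinearMap.ker (LinearMap.toSpanSingleton k M m)) →ₗ[k] Submodule.span k {x} :=
    Submodule.liftQ _ (LinearMap.codRestrict _ (LinearMap.toSpanSingleton k J x) fun r =>
      Submodule.mem_span_singleton.2 ⟨r, rfl⟩) fun r hr => LinearMap.mem_ker.2 (Subtype.ext (hx r hr))
  have hp : Function.Surjective p := by
    rintro ⟨z, hz⟩
    obtain ⟨r, rfl⟩ := Submodule.mem_span_singleton.1 hz
    exact ⟨Submodule.Quotient.mk r, rfl⟩
  have hs : IsSimpleModule k (k ⧸ LinearMap.ker (LinearMap.toSpanSingleton k M m)) :=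
    isSimpleModule_iff_isCoatom.2 hmax.out
  calc Module.length k (M →ₗ[k] J) ≤ Module.length k (Submodule.span k {x}) :=
        Module.length_le_of_injective e he
    _ ≤ Module.length k (k ⧸ LinearMap.ker (LinearMap.toSpanSingleton k M m)) :=
        Module.length_le_of_surjective p hp
    _ = 1 := Module.length_eq_one k _

/-- Induction along a composition series. Left exactness of Hom(-, J) is enough, as only an
inequality is needed. -/
theorem IsMinimalInjectiveCogenerator.length_dual_le (hJ : IsMinimalInjectiveCogenerator k J)
    {M : Type*} [AddCommGroup M] [Module k M] (hM : IsFiniteLength k M) :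
    Module.length k (M →ₗ[k] J) ≤ Module.length k M := by
  induction hM with
  | @of_subsingleton M _ _ _ =>
    have : Subsingleton (M →ₗ[k] J) := ⟨fun f g => LinearMap.ext fun x => by
      rw [Subsingleton.elim x 0, map_zero, map_zero]⟩
    rw [Module.length_eq_zero]
    exact zero_le
  | @of_simple_quotient M _ _ N _ _ ih =>
    rw [Module.length_eq_add_of_exact N.subtype N.mkQ N.injective_subtype N.mkQ_surjective
      (LinearMap.exact_subtype_mkQ N)]
    let r : (M →ₗ[k] J) →ₗ[k] (N →ₗ[k] J) := LinearMap.lcomp k J N.subtype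
    let i : (M ⧸ N →ₗ[k] J) →ₗ[k] (M →ₗ[k] J) := LinearMap.lcomp k J N.mkQ
    have hker : LinearMap.ker r ≤ LinearMap.range i := fun φ hφ =>
      ⟨N.liftQ φ fun x hx => LinearMap.congr_fun (LinearMap.mem_ker.1 hφ) ⟨x, hx⟩,
        LinearMap.ext fun _ => rfl⟩
    rw [Module.length_eq_add_of_exact (LinearMap.ker r).subtype r.rangeRestrict
      (Submodule.injective_subtype _) r.surjective_rangeRestrict
      (LinearMap.exact_iff.2 (by rw [LinearMap.ker_rangeRestrict, Submodule.range_subtype])),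
      add_comm]
    refine add_le_add ?_ ?_
    · exact (Module.length_le_of_injective _ (Submodule.injective_subtype _)).trans ih
    · calc Module.length k (LinearMap.ker r) ≤ Module.length k (LinearMap.range i) :=
            Module.length_le_of_injective _ (Submodule.inclusion_injective hker)
        _ ≤ Module.length k (M ⧸ N →ₗ[k] J) :=
            Module.length_le_of_surjective _ i.surjective_rangeRestrict
        _ ≤ 1 := hJ.length_dual_le_one
        _ = Module.length k (M ⧸ N) := (Module.length_eq_one k _).symm

theorem isFiniteLength_of_finite [IsArtinianRing k] {M : Type*} [AddCommGroup M] [Module k M]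
    [Module.Finite k M] : IsFiniteLength k M :=
  isFiniteLength_iff_isNoetherian_isArtinian.2 ⟨inferInstance, inferInstance⟩

theorem IsMinimalInjectiveCogenerator.isNoetherian_dual [IsArtinianRing k]
    (hJ : IsMinimalInjectiveCogenerator k J) {M : Type*} [AddCommGroup M] [Module k M]
    [Module.Finite k M] : IsNoetherian k (M →ₗ[k] J) := by
  have hM := isFiniteLength_of_finite (k := k) (M := M)
  exact (isFiniteLength_iff_isNoetherian_isArtinian.1 (Module.length_ne_top_iff.1
    (ne_top_of_le_ne_top (Module.length_ne_top_iff.2 hM) (hJ.length_dual_le hM)))).1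

/-- The double annihilator of a submodule of the dual of `M` is that submodule. -/
theorem IsMinimalInjectiveCogenerator.mem_of_forall_apply_eq_zero [IsArtinianRing k]
    (hJ : IsMinimalInjectiveCogenerator k J) {M : Type*} [AddCommGroup M] [Module k M]
    [Module.Finite k M] (H : Submodule k (M →ₗ[k] J)) (φ : M →ₗ[k] J)
    (hφ : ∀ m, (∀ ψ ∈ H, ψ m = 0) → φ m = 0) : φ ∈ H := by
  have hM := isFiniteLength_of_finite (k := k) (M := M)
  have hDM : IsFiniteLength k (M →ₗ[k] J) := Module.length_ne_top_iff.1
    (ne_top_of_le_ne_top (Module.length_ne_top_iff.2 hM) (hJ.length_dual_le hM))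
  -- N is the common kernel of H, and A consists of the functionals vanishing on N, so H ≤ A.
  -- Evaluation embeds M ⧸ N into the dual of H, so ℓ(A) ≤ ℓ(M ⧸ N) ≤ ℓ(H), which forces H = A.
  let ev : M →ₗ[k] (H →ₗ[k] J) := (LinearMap.lcomp k J H.subtype) ∘ₗ LinearMap.applyₗ
  let N := LinearMap.ker ev
  let A := LinearMap.range (LinearMap.lcomp k J N.mkQ : (M ⧸ N →ₗ[k] J) →ₗ[k] (M →ₗ[k] J))
  have hA : ∀ χ : M →ₗ[k] J, (∀ m, (∀ ψ ∈ H, ψ m = 0) → χ m = 0) → χ ∈ A := fun χ hχ =>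
    ⟨N.liftQ χ fun m hm => hχ m fun ψ hψ =>
      LinearMap.congr_fun (LinearMap.mem_ker.1 hm) ⟨ψ, hψ⟩, LinearMap.ext fun _ => rfl⟩
  have hHA : H ≤ A := fun χ hχ => hA χ fun m hm => hm χ hχ
  have hlen : Module.length k A ≤ Module.length k H :=
    calc Module.length k A ≤ Module.length k (M ⧸ N →ₗ[k] J) :=
          Module.length_le_of_surjective _ (LinearMap.surjective_rangeRestrict _)
      _ ≤ Module.length k (M ⧸ N) := hJ.length_dual_le isFiniteLength_of_finite
      _ ≤ Module.length k (H →ₗ[k] J) := Module.length_le_of_injective (N.liftQ ev le_rfl)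
          (LinearMap.ker_eq_bot.1 (Submodule.ker_liftQ_eq_bot _ _ _ le_rfl))
      _ ≤ Module.length k H := hJ.length_dual_le (hDM.of_injective H.injective_subtype)
  have : H = A := by
    obtain ⟨_, _⟩ := isFiniteLength_iff_isNoetherian_isArtinian.1 hDM
    by_contra hne
    have hlt := Submodule.height_strictMono (lt_of_le_of_ne hHA hne)
    rw [Module.length_submodule, Module.length_submodule] at hlen
    exact absurd hlt hlen.not_gt
  exact this ▸ hA φ hφ

end Duality
/-! ### Right equivalence classes -/

section Classes

variable {𝒞 : Type u} [Category.{v} 𝒞]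

theorem rightClass_le_iff {W W' Y : 𝒞} (f : W ⟶ Y) (f' : W' ⟶ Y) :
    rightClass f ≤ rightClass f' ↔ ∃ v : W ⟶ W', v ≫ f' = f :=
  toAntisymmetrization_le_toAntisymmetrization_iff

theorem RightDetermined.of_rightClass_eq {C W W' Y : 𝒞} {f : W ⟶ Y} {f' : W' ⟶ Y}
    (hf : RightDetermined C f) (h : rightClass f = rightClass f') : RightDetermined C f' := by
  obtain ⟨v, hv⟩ := (rightClass_le_iff f f').1 h.le
  obtain ⟨v', hv'⟩ := (rightClass_le_iff f' f).1 h.ge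
  intro L g hg
  obtain ⟨s, hs⟩ := hf g fun h => by
    obtain ⟨t, ht⟩ := hg h
    exact ⟨t ≫ v', by rw [Category.assoc, hv', ht]⟩
  exact ⟨s ≫ v, by rw [Category.assoc, hv, hs]⟩

end Classes

theorem inAdd_biproduct {𝒞 : Type u} [Category.{v} 𝒞] [Preadditive 𝒞] [HasFiniteBiproducts 𝒞]
    (X : 𝒞) (m : ℕ) : InAdd X (⨁ fun _ : Fin m => X) := by
  have := hasZeroObject_of_hasFiniteBiproducts 𝒞
  open ZeroObject in
  exact ⟨m, 0, ⟨{ hom := biprod.fst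
                  inv := biprod.inl
                  hom_inv_id := by ext; simp }⟩⟩

variable {k : Type uk} [CommRing k] {𝒞 : Type u} [Category.{v} 𝒞] [Preadditive 𝒞] [Linear k 𝒞]

/-! ### Extensions of objects of add X, and finite generation -/

namespace ExtBifunctor

variable {E : ExtBifunctor.{w} k 𝒞}

theorem push_sum {ι : Type*} (s : Finset ι) {C A A' : 𝒞} (g : ι → (A ⟶ A')) (δ : E.Ext C A) :
    E.push C (∑ i ∈ s, g i) δ = ∑ i ∈ s, E.push C (g i) δ := by
  classical
  induction s using Finset.induction_on with
  | empty => rw [Finset.sum_empty, Finset.sum_empty, push_zero]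
  | insert i s hi ih => rw [Finset.sum_insert hi, Finset.sum_insert hi, push_add, ih]

/-- An extension of an object of `add X` vanishes if all its images under morphisms to `X` do. -/
theorem eq_zero_of_inAdd [HasFiniteBiproducts 𝒞] {X X₀ C : 𝒞} (hX : InAdd X X₀) (δ : E.Ext C X₀)
    (h : ∀ p : X₀ ⟶ X, E.push C p δ = 0) : δ = 0 := by
  obtain ⟨m, Z', ⟨e⟩⟩ := hX
  have hid : 𝟙 X₀ = ∑ i : Fin m, (biprod.inl ≫ e.hom ≫ biproduct.π (fun _ : Fin m => X) i) ≫
      (biproduct.ι (fun _ : Fin m => X) i ≫ e.inv ≫ biprod.fst) := by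
    calc 𝟙 X₀ = (biprod.inl ≫ e.hom) ≫ (∑ i : Fin m, biproduct.π (fun _ : Fin m => X) i ≫
          biproduct.ι (fun _ : Fin m => X) i) ≫ e.inv ≫ biprod.fst := by
          rw [biproduct.total]; simp
      _ = _ := by simp only [Preadditive.sum_comp, Preadditive.comp_sum, Category.assoc]
  rw [← E.push_id C X₀ δ, hid, push_sum]
  exact Finset.sum_eq_zero fun i _ => by rw [push_comp, h, map_zero]

variable (E) in
/-- Any finite family in `𝔼(C, X)` comes from one extension of a finite direct sum of copies of `X`,
whose images under morphisms to `X` form the submodule spanned by the family. -/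
theorem exists_range_sharp_eq [HasFiniteBiproducts 𝒞] {X Y : 𝒞} (F : Submodule (End X) (E.Ext Y X))
    (hF : F.FG) : ∃ (m : ℕ) (δ : E.Ext Y (⨁ fun _ : Fin m => X)),
      LinearMap.range (E.sharp δ X) = F := by
  obtain ⟨m, x, hx⟩ := Submodule.fg_iff_exists_fin_generating_family.1 hF
  refine ⟨m, ∑ i, E.push Y (biproduct.ι (fun _ : Fin m => X) i) (x i), ?_⟩
  have key : ∀ g : (⨁ fun _ : Fin m => X) ⟶ X,
      E.push Y g (∑ i, E.push Y (biproduct.ι (fun _ : Fin m => X) i) (x i)) =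
        ∑ i, E.push Y (biproduct.ι (fun _ : Fin m => X) i ≫ g) (x i) := fun g => by
    rw [map_sum]
    simp only [push_comp]
  apply le_antisymm
  · rintro _ ⟨g, rfl⟩
    change E.push Y g _ ∈ F
    rw [key]
    exact F.sum_mem fun i _ => F.smul_mem
      (biproduct.ι (fun _ : Fin m => X) i ≫ g : End X) (hx ▸ Submodule.subset_span ⟨i, rfl⟩)
  · rw [← hx, Submodule.span_le]
    rintro _ ⟨j, rfl⟩
    refine ⟨biproduct.π (fun _ : Fin m => X) j, ?_⟩
    change E.push Y _ _ = x j
    rw [key, Finset.sum_eq_single j]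
    · rw [biproduct.ι_π_self, push_id]
    · intro i _ hij
      rw [biproduct.ι_π_ne _ hij, push_zero]
    · exact fun h => absurd (Finset.mem_univ j) h

/-- The `k`-submodule underlying an `End X`-submodule of `𝔼(Y, X)`. -/
def restrictEnd {X Y : 𝒞} (F : Submodule (End X) (E.Ext Y X)) : Submodule k (E.Ext Y X) where
  carrier := F
  zero_mem' := F.zero_mem
  add_mem' := F.add_mem
  smul_mem' r δ hδ := by
    rw [← E.push_id Y X δ, ← E.push_smul]
    exact F.smul_mem (r • 𝟙 X : End X) hδ

/-- The `k`-submodule underlying an `(End C)ᵒᵖ`-submodule of `𝒞̲(C, Y)`. -/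
def restrictStable {C Y : 𝒞} (H : Submodule (End C)ᵐᵒᵖ (E.StableHom C Y)) :
    Submodule k (E.StableHom C Y) where
  carrier := H
  zero_mem' := H.zero_mem
  add_mem' := H.add_mem
  smul_mem' r h hh := by
    have key : r • h = (MulOpposite.op (r • 𝟙 C) : (End C)ᵐᵒᵖ) • h := by
      obtain ⟨g, rfl⟩ := E.toStable.map_surjective h
      change _ = E.toStable.map (r • 𝟙 C) ≫ E.toStable.map g
      rw [← Functor.map_comp, Linear.smul_comp, Category.id_comp]
      rfl
    rw [key]
    exact H.smul_mem _ hh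

theorem fg_of_restrictEnd_fg {X Y : 𝒞} (F : Submodule (End X) (E.Ext Y X))
    (h : (restrictEnd F).FG) : F.FG := by
  obtain ⟨s, hs⟩ := h
  refine ⟨s, le_antisymm (Submodule.span_le.2 fun x hx => ?_) fun x hx => ?_⟩
  · exact (hs ▸ Submodule.subset_span hx : x ∈ restrictEnd F)
  · have hx' : x ∈ Submodule.span k (s : Set (E.Ext Y X)) := hs ▸ hx
    exact (Submodule.span_le.2 Submodule.subset_span :
      Submodule.span k (s : Set (E.Ext Y X)) ≤ restrictEnd (Submodule.span (End X) _)) hx'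

theorem fg_of_restrictStable_fg {C Y : 𝒞} (H : Submodule (End C)ᵐᵒᵖ (E.StableHom C Y))
    (h : (restrictStable H).FG) : H.FG := by
  obtain ⟨s, hs⟩ := h
  refine ⟨s, le_antisymm (Submodule.span_le.2 fun x hx => ?_) fun x hx => ?_⟩
  · exact (hs ▸ Submodule.subset_span hx : x ∈ restrictStable H)
  · have hx' : x ∈ Submodule.span k (s : Set (E.StableHom C Y)) := hs ▸ hx
    exact (Submodule.span_le.2 Submodule.subset_span :
      Submodule.span k (s : Set (E.StableHom C Y)) ≤
        restrictStable (Submodule.span (End C)ᵐᵒᵖ _)) hx'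

theorem ExtFinite.fg [IsArtinianRing k] (hE : E.ExtFinite) {X Y : 𝒞}
    (F : Submodule (End X) (E.Ext Y X)) : F.FG := by
  have := hE Y X
  exact fg_of_restrictEnd_fg F (IsNoetherian.noetherian _)

theorem eta_mono {C Y : 𝒞} {c c' : RightClass Y} (h : c ≤ c') : E.eta C Y c ≤ E.eta C Y c' := by
  induction c using Antisymmetrization.ind with | _ f
  induction c' using Antisymmetrization.ind with | _ f'
  obtain ⟨v, hv⟩ := (rightClass_le_iff f.hom f'.hom).1 h
  rintro _ ⟨g, rfl⟩
  refine ⟨g ≫ E.toStable.map v, ?_⟩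
  change (g ≫ E.toStable.map v) ≫ E.toStable.map f'.hom = g ≫ E.toStable.map f.hom
  rw [Category.assoc, ← Functor.map_comp, hv]

/-! ### Annihilators under Auslander-Reiten-Serre duality -/

namespace ARSDuality

variable {J : Type uk} [AddCommGroup J] [Module k J] (D : E.ARSDuality J)

/-- Naturality of Φ in its first argument, combined with naturality of the counit θ. -/
theorem Psi_pull {X Y Y' : 𝒞} (x : Y ⟶ Y') (φ : E.Ext Y X →ₗ[k] J) :
    D.Psi Y' X (φ ∘ₗ E.pull x X) = D.Psi Y X φ ≫ E.toStable.map x := by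
  have h := D.natural x (𝟙 X) φ
  have h1 : φ ∘ₗ E.pull x X ∘ₗ E.push Y' (𝟙 X) = φ ∘ₗ E.pull x X := by
    ext δ
    simp [E.push_id]
  rw [h1, E.toCostable.map_id, Category.id_comp] at h
  change D.vartheta Y' X (D.Phi Y' X (φ ∘ₗ E.pull x X)) = _
  rw [h]
  change D.tau.inverse.map (D.Phi Y X φ ≫ D.tau.functor.map (E.toStable.map x)) ≫ _ =
    (D.tau.inverse.map (D.Phi Y X φ) ≫ D.tau.unitIso.inv.app (E.toStable.obj Y)) ≫ _
  rw [D.tau.inverse.map_comp, Category.assoc, Category.assoc]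
  congr 1
  exact D.tau.unitIso.inv.naturality (E.toStable.map x)

theorem Psi_mem_upsilon_iff {X Y : 𝒞} (F : Submodule (End X) (E.Ext Y X))
    (φ : E.Ext Y X →ₗ[k] J) : D.Psi Y X φ ∈ D.upsilon F ↔ ∀ δ ∈ F, φ δ = 0 := by
  change (∀ δ ∈ F, (D.Psi Y X).symm (D.Psi Y X φ) δ = 0) ↔ _
  rw [LinearEquiv.symm_apply_apply]

/-- The annihilator in `𝔼(Y, X)` of a submodule of `𝒞̲(τ⁻ X, Y)`. -/
def annihilator {X Y : 𝒞}
    (H : Submodule (End (D.tauInv X))ᵐᵒᵖ (E.StableHom (D.tauInv X) Y)) :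
    Submodule (End X) (E.Ext Y X) where
  carrier := {δ | ∀ h ∈ H, (D.Psi Y X).symm h δ = 0}
  zero_mem' h _ := map_zero _
  add_mem' hδ hε h hh := by rw [map_add, hδ h hh, hε h hh, add_zero]
  smul_mem' a δ hδ h hh := by
    obtain ⟨t, ht⟩ := E.toStable.map_surjective (D.tau.inverse.map (E.toCostable.map a))
    have key := D.Psi_push X Y a t ht.symm ((D.Psi Y X).symm h)
    rw [LinearEquiv.apply_symm_apply] at key
    have := hδ _ (H.smul_mem (MulOpposite.op t) hh)
    rwa [← key, LinearEquiv.symm_apply_apply] at this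

/-- Transported along Ψ, this is the double annihilator property of k-submodules of the dual of 𝔼(Y,
X). -/
theorem upsilon_annihilator [IsArtinianRing k] (hJ : IsMinimalInjectiveCogenerator k J)
    (hE : E.ExtFinite) {X Y : 𝒞}
    (H : Submodule (End (D.tauInv X))ᵐᵒᵖ (E.StableHom (D.tauInv X) Y)) :
    D.upsilon (D.annihilator H) = H := by
  have := hE Y X
  apply le_antisymm
  · intro h hh
    have key := hJ.mem_of_forall_apply_eq_zero
      ((restrictStable H).comap (D.Psi Y X).toLinearMap) ((D.Psi Y X).symm h) fun δ hδ => by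
        refine hh δ fun g hg => hδ _ ?_
        change D.Psi Y X ((D.Psi Y X).symm g) ∈ H
        rwa [LinearEquiv.apply_symm_apply]
    have key' : D.Psi Y X ((D.Psi Y X).symm h) ∈ H := key
    rwa [LinearEquiv.apply_symm_apply] at key'
  · exact fun h hh δ hδ => hδ h hh

theorem fg_stableHom [IsArtinianRing k] (hJ : IsMinimalInjectiveCogenerator k J)
    (hE : E.ExtFinite) {X Y : 𝒞}
    (H : Submodule (End (D.tauInv X))ᵐᵒᵖ (E.StableHom (D.tauInv X) Y)) : H.FG := by
  have := hE Y X
  have := hJ.isNoetherian_dual (M := E.Ext Y X)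
  have := isNoetherian_of_linearEquiv (D.Psi Y X)
  exact fg_of_restrictStable_fg H (IsNoetherian.noetherian _)

end ARSDuality
end ExtBifunctor

/-! ### Deflations and their extensions -/

namespace NExangulated

open ExtBifunctor

variable [HasFiniteBiproducts 𝒞] {E : ExtBifunctor.{w} k 𝒞} {n : ℕ} (S : NExangulated E n)

theorem exists_isLastOf {A Y : 𝒞} (δ : E.Ext Y A) :
    ∃ (W : 𝒞) (f : W ⟶ Y), S.s.IsLastOf f δ := by
  obtain ⟨K, hK⟩ := Quotient.exists_rep (S.s δ)
  exact ⟨_, K.dLast, K, hK.symm, Iso.refl _, Category.id_comp _⟩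

variable {S}

/-- `g` factors through the last morphism of an `n`-exangle iff it pulls its extension back
to zero. -/
theorem exists_comp_eq_iff_pull_eq_zero {A W Y Z : 𝒞} {f : W ⟶ Y} {δ : E.Ext Y A}
    (hf : S.s.IsLastOf f δ) (g : Z ⟶ Y) : (∃ v : Z ⟶ W, v ≫ f = g) ↔ E.pull g A δ = 0 := by
  obtain ⟨K, hK, b, rfl⟩ := hf
  refine Iff.trans ⟨?_, ?_⟩ ((S.exangle δ K hK).exact_to_last Z g).symm
  · rintro ⟨v, rfl⟩
    exact ⟨v ≫ b.hom, Category.assoc _ _ _⟩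
  · rintro ⟨v, rfl⟩
    exact ⟨v ≫ b.inv, by simp⟩

/-- Exactness of `𝒞(A, B) → 𝔼(Y, B) → 𝔼(W, B)` for an `n`-exangle with first term `A` and last
morphism `f : W ⟶ Y`. -/
theorem pull_eq_zero_iff (hn : 1 ≤ n) {A B W Y : 𝒞} {f : W ⟶ Y} {δ : E.Ext Y A}
    (hf : S.s.IsLastOf f δ) (ε : E.Ext Y B) :
    E.pull f B ε = 0 ↔ ∃ a : A ⟶ B, E.push Y a δ = ε := by
  have hfδ : E.pull f A δ = 0 :=
    (exists_comp_eq_iff_pull_eq_zero hf f).1 ⟨𝟙 W, Category.id_comp f⟩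
  constructor
  · intro hε
    obtain ⟨K, hK, b, rfl⟩ := hf
    have hε' : E.pull K.dLast B ε = 0 := by
      rw [pull_comp] at hε
      rw [← E.pull_id _ _ (E.pull K.dLast B ε), ← b.inv_hom_id, pull_comp, hε, map_zero]
    have hδ' : E.pull K.dLast A δ = 0 := (S.exangle δ K hK).pull_zero
    -- ρ is the extension with components δ and ε. Lifting `biprod.fst`, which sends ρ to δ, gives a
    -- mapping cocone N with first term A ⊞ B. It realizes the pullback of ρ to the middle term of
    -- K, which is zero, so the first morphism of N splits.
    let ρ : E.Ext Y (A ⊞ B) := E.push Y biprod.inl δ + E.push Y biprod.inr ε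
    have hρ : E.push Y biprod.fst ρ = δ := by
      rw [map_add, ← push_comp, ← push_comp, biprod.inl_fst, biprod.inr_fst, push_id, push_zero,
        add_zero]
    obtain ⟨L, hL⟩ := Quotient.exists_rep (S.s ρ)
    have hK' : S.s.Realizes K (E.push Y biprod.fst ρ) := by rwa [hρ]
    obtain ⟨φ, hφ, N, ⟨hN⟩, hNr⟩ := S.good_colift ρ biprod.fst L K hL.symm hK'
    have hzero : E.pull K.dLast (A ⊞ B) ρ = 0 := by
      rw [map_add, ← push_pull, ← push_pull, hδ', hε', map_zero, map_zero, add_zero]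
    rw [hzero] at hNr
    obtain ⟨r, hr⟩ := ((S.exangle _ N hNr).exact_from_first _ (𝟙 (A ⊞ B))).1 (map_zero _)
    have hr : N.dFirst ≫ r = 𝟙 _ := hr
    let t : L.K.X 1 ⟶ A ⊞ B := biprod.inl ≫ (hN.iso 1 0 rfl hn).hom ≫ r
    -- On the summand B the second component of the first morphism of N vanishes, since `biprod.fst`
    -- kills B. So the splitting already gives a retraction of B → L₁.
    have ht : biprod.inr ≫ L.dFirst ≫ t ≫ biprod.snd = 𝟙 B := by
      have h1 : biprod.inr ≫ N.dFirst = (biprod.inr ≫ L.dFirst) ≫ biprod.inl ≫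
          (hN.iso 1 0 rfl hn).hom := by
        rw [hN.first hn, hφ.1, ← Category.assoc, ← Category.assoc]
        congr 1
        ext <;> simp
      calc biprod.inr ≫ L.dFirst ≫ t ≫ biprod.snd
          = (biprod.inr ≫ N.dFirst) ≫ r ≫ biprod.snd := by
            rw [h1]; simp only [t, Category.assoc]
        _ = 𝟙 B := by rw [Category.assoc, reassoc_of% hr, biprod.inr_snd]
    refine ⟨-(biprod.inl ≫ L.dFirst ≫ t ≫ biprod.snd), ?_⟩
    -- The first morphism of L kills ρ. Following it by the retraction gives a_*δ + ε = 0, where a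
    -- is the restriction of the composite to A.
    have h0 : E.push Y (L.dFirst ≫ t ≫ biprod.snd) ρ = 0 := by
      rw [push_comp, (S.exangle ρ L hL.symm).push_zero, map_zero]
    rw [map_add, ← push_comp, ← push_comp, ht, push_id] at h0
    have hneg := E.push_add Y (-(biprod.inl ≫ L.dFirst ≫ t ≫ biprod.snd))
      (biprod.inl ≫ L.dFirst ≫ t ≫ biprod.snd) δ
    rw [neg_add_cancel, push_zero] at hneg
    rw [eq_neg_of_add_eq_zero_left hneg.symm, ← eq_neg_of_add_eq_zero_right h0]
  · rintro ⟨a, rfl⟩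
    rw [← push_pull, hfδ, map_zero]

theorem rightClass_le_iff_exists_push (hn : 1 ≤ n) {A A' W W' Y : 𝒞} {f : W ⟶ Y} {f' : W' ⟶ Y}
    {δ : E.Ext Y A} {δ' : E.Ext Y A'} (hf : S.s.IsLastOf f δ) (hf' : S.s.IsLastOf f' δ') :
    rightClass f ≤ rightClass f' ↔ ∃ a : A ⟶ A', E.push Y a δ = δ' := by
  rw [rightClass_le_iff, exists_comp_eq_iff_pull_eq_zero hf', pull_eq_zero_iff hn hf]

theorem range_sharp_le (hn : 1 ≤ n) (X : 𝒞) {A A' W W' Y : 𝒞} {f : W ⟶ Y} {f' : W' ⟶ Y}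
    {δ : E.Ext Y A} {δ' : E.Ext Y A'} (hf : S.s.IsLastOf f δ) (hf' : S.s.IsLastOf f' δ')
    (h : rightClass f ≤ rightClass f') :
    LinearMap.range (E.sharp δ' X) ≤ LinearMap.range (E.sharp δ X) := by
  obtain ⟨a, rfl⟩ := (rightClass_le_iff_exists_push hn hf hf').1 h
  rintro _ ⟨g, rfl⟩
  exact ⟨a ≫ g, E.push_comp Y a g δ⟩

/-- A morphism `C → Y` factors through a deflation to `Y` iff it does so in the stable category. -/
theorem map_mem_eta_iff {A W Y : 𝒞} {f : W ⟶ Y} {δ : E.Ext Y A} (hf : S.s.IsLastOf f δ) {C : 𝒞}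
    (h : C ⟶ Y) : E.toStable.map h ∈ E.eta C Y (rightClass f) ↔ ∃ t : C ⟶ W, t ≫ f = h := by
  constructor
  · rintro ⟨t, ht⟩
    obtain ⟨t, rfl⟩ := E.toStable.map_surjective t
    have ht : E.toStable.map (t ≫ f) = E.toStable.map h := (Functor.map_comp _ _ _).trans ht
    -- Morphisms with projectively trivial difference pull δ back to the same extension, so both
    -- factor through f or neither does.
    have hrel : E.ProjTrivial (t ≫ f - h) :=
      (Quotient.functor_map_eq_iff E.stableRel (t ≫ f) h).1 ht
    rw [exists_comp_eq_iff_pull_eq_zero hf, ← (projTrivial_sub_iff _ _).1 hrel,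
      ← exists_comp_eq_iff_pull_eq_zero hf]
    exact ⟨t, rfl⟩
  · rintro ⟨t, rfl⟩
    exact ⟨E.toStable.map t, (E.toStable.map_comp t f).symm⟩

/-! ### The commuting triangle and the Auslander bijection -/

variable {J : Type uk} [AddCommGroup J] [Module k J]

/-- Both sides correspond under Ψ to the functionals on 𝔼(Y, X) that vanish on ker f^*. They are
exactly those of the form ψ ∘ f^*, because J is injective. -/
theorem eta_eq_upsilon (hn : 1 ≤ n) (hJ : IsInjectiveCogenerator k J) (D : E.ARSDuality J) (X : 𝒞)
    {A W Y : 𝒞} {f : W ⟶ Y} {δ : E.Ext Y A} (hf : S.s.IsLastOf f δ) :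
    E.eta (D.tauInv X) Y (rightClass f) = D.upsilon (LinearMap.range (E.sharp δ X)) := by
  ext h
  obtain ⟨φ, rfl⟩ := (D.Psi Y X).surjective h
  rw [D.Psi_mem_upsilon_iff]
  constructor
  · rintro ⟨g, hg⟩ _ ⟨a, rfl⟩
    obtain ⟨ψ, rfl⟩ := (D.Psi W X).surjective g
    have hg : D.Psi W X ψ ≫ E.toStable.map f = D.Psi Y X φ := hg
    rw [← D.Psi_pull] at hg
    rw [← (D.Psi Y X).injective hg]
    change ψ (E.pull f X (E.push Y a δ)) = 0
    rw [(pull_eq_zero_iff hn hf _).2 ⟨a, rfl⟩, map_zero]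
  · intro hφ
    have hker : LinearMap.ker (E.pull f X) ≤ LinearMap.ker φ := fun ε hε => by
      obtain ⟨a, rfl⟩ := (pull_eq_zero_iff hn hf ε).1 hε
      exact hφ _ ⟨a, rfl⟩
    obtain ⟨ψ, hψ⟩ := Module.Baer.extension_property hJ.baer
      ((LinearMap.ker (E.pull f X)).liftQ (E.pull f X) le_rfl)
      (LinearMap.ker_eq_bot.1 (Submodule.ker_liftQ_eq_bot _ _ _ le_rfl))
      ((LinearMap.ker (E.pull f X)).liftQ φ hker)
    refine ⟨D.Psi W X ψ, ?_⟩
    change D.Psi W X ψ ≫ E.toStable.map f = _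
    rw [← D.Psi_pull]
    congr 1
    ext ε
    exact LinearMap.congr_fun hψ (Submodule.Quotient.mk ε)

/-- The last morphism of an `n`-exangle with first term in `add X` is right `τ⁻ X`-determined. -/
theorem rightDetermined_of_inAdd (hn : 1 ≤ n) (hJ : IsInjectiveCogenerator k J)
    (D : E.ARSDuality J) {X X₀ W Y : 𝒞} (hX : InAdd X X₀) {f : W ⟶ Y} {δ : E.Ext Y X₀}
    (hf : S.s.IsLastOf f δ) : RightDetermined (D.tauInv X) f := by
  intro L g hg
  rw [exists_comp_eq_iff_pull_eq_zero hf]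
  refine eq_zero_of_inAdd hX _ fun p => ?_
  by_contra hne
  obtain ⟨φ, hφ⟩ := hJ.exists_ne_zero hne
  obtain ⟨h, hh⟩ := E.toStable.map_surjective (D.Psi L X φ)
  -- The stable class of h ≫ g corresponds to φ ∘ g^*. As h ≫ g factors through f, this functional
  -- kills p_*δ, against the choice of φ.
  have hmem := (map_mem_eta_iff hf (h ≫ g)).2 (hg h)
  rw [eta_eq_upsilon hn hJ D X hf, Functor.map_comp, hh, ← D.Psi_pull,
    D.Psi_mem_upsilon_iff] at hmem
  refine hφ ?_
  rw [push_pull]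
  exact hmem _ ⟨p, rfl⟩

/-- A right `C`-determined deflation is determined by its image under `η`. -/
theorem rightClass_le_of_eta_le {C W W' Y : 𝒞} {f : W ⟶ Y} {f' : W' ⟶ Y}
    (hf : S.s.IsDeflation f) (hf' : S.s.IsDeflation f') (hdet : RightDetermined C f')
    (h : E.eta C Y (rightClass f) ≤ E.eta C Y (rightClass f')) :
    rightClass f ≤ rightClass f' := by
  obtain ⟨_, δ, hf⟩ := hf
  obtain ⟨_, δ', hf'⟩ := hf'
  rw [rightClass_le_iff]
  exact hdet f fun g => (map_mem_eta_iff hf' _).1 (h ((map_mem_eta_iff hf _).2 ⟨g, rfl⟩))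

/-- A class may be a deflation class and a determined class through different representatives. Right
determination is invariant under right equivalence, so one representative serves for both. -/
theorem exists_of_mem {C Y : 𝒞} {c : RightClass Y} (hc : c ∈ S.determinedDeflationClasses C Y) :
    ∃ (W : 𝒞) (f : W ⟶ Y), S.s.IsDeflation f ∧ RightDetermined C f ∧ rightClass f = c := by
  obtain ⟨⟨W, f, hf, rfl⟩, W', f', hf', h⟩ := hc
  exact ⟨W, f, hf, hf'.of_rightClass_eq h, rfl⟩

theorem eta_le_iff {C Y : 𝒞} (c c' : S.determinedDeflationClasses C Y) :
    E.eta C Y c.1 ≤ E.eta C Y c'.1 ↔ c ≤ c' := by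
  refine ⟨fun h => ?_, eta_mono⟩
  obtain ⟨c, hc⟩ := c
  obtain ⟨c', hc'⟩ := c'
  obtain ⟨W, f, hf, -, rfl⟩ := exists_of_mem hc
  obtain ⟨W', f', hf', hdet, rfl⟩ := exists_of_mem hc'
  exact rightClass_le_of_eta_le hf hf' hdet h

theorem addClasses_subset (hn : 1 ≤ n) (hJ : IsInjectiveCogenerator k J) (D : E.ARSDuality J)
    (X Y : 𝒞) : S.addClasses X Y ⊆ S.determinedDeflationClasses (D.tauInv X) Y := by
  rintro _ ⟨W, X₀, f, δ, hX, hf, rfl⟩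
  exact ⟨⟨W, f, ⟨X₀, δ, hf⟩, rfl⟩, W, f, rightDetermined_of_inAdd hn hJ D hX hf, rfl⟩

/-- Every finitely generated submodule of `𝔼(Y, X)` belongs to an `n`-exangle with first term
in `add X`. -/
theorem exists_mem_addClasses (hn : 1 ≤ n) (hJ : IsInjectiveCogenerator k J)
    (D : E.ARSDuality J) {X Y : 𝒞} (F : Submodule (End X) (E.Ext Y X)) (hF : F.FG) :
    ∃ c ∈ S.addClasses X Y, E.eta (D.tauInv X) Y c = D.upsilon F := by
  obtain ⟨m, δ, rfl⟩ := E.exists_range_sharp_eq F hF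
  obtain ⟨W, f, hf⟩ := S.exists_isLastOf δ
  exact ⟨_, ⟨W, _, f, δ, inAdd_biproduct X m, hf, rfl⟩, eta_eq_upsilon hn hJ D X hf⟩

/-- For the converse inclusion, a determined class is compared with the class built in add X from
its own submodule {g_*δ}. Both have the same image under η, which is injective on determined
classes. -/
theorem addClasses_eq [IsArtinianRing k] (hn : 1 ≤ n) (hJ : IsInjectiveCogenerator k J)
    (hE : E.ExtFinite) (D : E.ARSDuality J) (X Y : 𝒞) :
    S.addClasses X Y = S.determinedDeflationClasses (D.tauInv X) Y := by
  refine (addClasses_subset hn hJ D X Y).antisymm fun c hc => ?_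
  obtain ⟨W, f, ⟨A, δ, hf⟩, -, rfl⟩ := exists_of_mem hc
  obtain ⟨c', hc', h⟩ := exists_mem_addClasses hn hJ D _ (hE.fg (LinearMap.range (E.sharp δ X)))
  rw [← eta_eq_upsilon hn hJ D X hf] at h
  have hmem := addClasses_subset hn hJ D X Y hc'
  have heq : (⟨c', hmem⟩ : S.determinedDeflationClasses (D.tauInv X) Y) = ⟨_, hc⟩ :=
    le_antisymm ((eta_le_iff _ _).1 h.le) ((eta_le_iff _ _).1 h.ge)
  have hval : c' = rightClass f := congrArg Subtype.val heq
  exact hval ▸ hc'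

theorem eta_surjective [IsArtinianRing k] (hn : 1 ≤ n) (hJ : IsMinimalInjectiveCogenerator k J)
    (hE : E.ExtFinite) (D : E.ARSDuality J) (X Y : 𝒞) :
    S.RestrictedAuslanderBijection (D.tauInv X) Y := by
  intro H
  obtain ⟨c, hc, h⟩ := exists_mem_addClasses hn hJ.1 D _ (hE.fg (D.annihilator H))
  exact ⟨⟨c, addClasses_subset hn hJ.1 D X Y hc⟩, h.trans (D.upsilon_annihilator hJ hE H)⟩

end NExangulated
end NExang
end

/-! ### Assembly of the three maps -/

theorem theorem4p15
    {k : Type uk} [CommRing k] [IsArtinianRing k]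
    {J : Type uk} [AddCommGroup J] [Module k J] (hJ : IsMinimalInjectiveCogenerator k J)
    {𝒞 : Type u} [Category.{v} 𝒞] [Preadditive 𝒞] [Linear k 𝒞] [HasFiniteBiproducts 𝒞]
    (hKS : IsKrullSchmidt 𝒞)
    (E : ExtBifunctor.{w} k 𝒞) (hE : E.ExtFinite)
    (n : ℕ) (hn : 1 ≤ n) (S : NExangulated E n) (hS : S.WIC)
    (D : E.ARSDuality J) (X Y : 𝒞) :
    S.addClasses X Y = S.determinedDeflationClasses (D.tauInv X) Y ∧
    ∃ (ξ : S.determinedDeflationClasses (D.tauInv X) Y →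
          {F : Submodule (End X) (E.Ext Y X) // F.FG})
      (Υ : {F : Submodule (End X) (E.Ext Y X) // F.FG} →
          {H : Submodule (End (D.tauInv X))ᵐᵒᵖ (E.StableHom (D.tauInv X) Y) // H.FG})
      (η : S.determinedDeflationClasses (D.tauInv X) Y ≃o
          {H : Submodule (End (D.tauInv X))ᵐᵒᵖ (E.StableHom (D.tauInv X) Y) // H.FG}),
      (∀ (c : S.determinedDeflationClasses (D.tauInv X) Y) (W A : 𝒞) (f : W ⟶ Y)
        (δ : E.Ext Y A), rightClass f = c.1 → S.s.IsLastOf f δ →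
          (ξ c).1 = LinearMap.range (E.sharp δ X)) ∧
      (∀ F, (Υ F).1 = D.upsilon F.1) ∧
      (∀ c, (η c).1 = E.eta (D.tauInv X) Y c.1) ∧
      (∀ c, η c = Υ (ξ c)) ∧
      S.RestrictedAuslanderBijection (D.tauInv X) Y := by
  have hsurj := NExangulated.eta_surjective (S := S) hn hJ hE D X Y
  have hclass : ∀ c : S.determinedDeflationClasses (D.tauInv X) Y,
      ∃ (W A : 𝒞) (f : W ⟶ Y) (δ : E.Ext Y A), rightClass f = c.1 ∧ S.s.IsLastOf f δ := by
    rintro ⟨_, ⟨W, f, ⟨A, δ, hf⟩, rfl⟩, -⟩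
    exact ⟨W, A, f, δ, rfl, hf⟩
  -- ξ is defined through a chosen representative. Two extensions with right equivalent last
  -- morphisms are pushforwards of each other, so the resulting submodule does not depend on the
  -- choice.
  choose W A f δ hc hf using hclass
  let η₀ : S.determinedDeflationClasses (D.tauInv X) Y ↪o
      {H : Submodule (End (D.tauInv X))ᵐᵒᵖ (E.StableHom (D.tauInv X) Y) // H.FG} :=
    OrderEmbedding.ofMapLEIff (fun c => ⟨E.eta (D.tauInv X) Y c.1, D.fg_stableHom hJ hE _⟩)
      NExangulated.eta_le_iff
  refine ⟨NExangulated.addClasses_eq hn hJ.1 hE D X Y,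
    fun c => ⟨LinearMap.range (E.sharp (δ c) X), hE.fg _⟩,
    fun F => ⟨D.upsilon F.1, D.fg_stableHom hJ hE _⟩,
    RelIso.ofSurjective η₀ fun H => (hsurj H.1).imp fun c h => Subtype.ext h,
    fun c W' A' f' δ' h hf' => ?_, fun F => rfl, fun c => rfl, fun c => Subtype.ext ?_, hsurj⟩
  · have heq : rightClass (f c) = rightClass f' := (hc c).trans h.symm
    exact le_antisymm (NExangulated.range_sharp_le hn X hf' (hf c) heq.ge)
      (NExangulated.range_sharp_le hn X (hf c) hf' heq.le)
  · change E.eta (D.tauInv X) Y c.1 = _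
    rw [← hc c]
    exact NExangulated.eta_eq_upsilon hn hJ.1 D X (hf c)
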